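/- Let $\Theta$ and $\mathbb Y$ be Polish metric spaces with their Borel $\sigma$-algebras. Call a measure \emph{locally finite} if it is finite on every set of bounded diameter, and let $\mathrm{BM}_+(X)$ be the set of nonnegative, measurable, bounded functions with bounded support on $X$. Let $H$ be a locally finite measure on $\Theta$, $\ell$ a $\sigma$-finite measure on $\mathbb Y$, $K:\mathbb Y\times\Theta\to[0,\infty)$ a jointly measurable kernel, and $\beta,c>0$ constants with $\rho=\beta c<1$. A locally finite random measure $W$ on $\Theta$ is a \emph{gamma random measure} $\mathrm{GaP}(H,b)$ with rate $b>0$ if $$\mathrm E\, e^{-\int f\,dW}=\exp\Big(-\int_\Theta\log\big(1+f/b\big)\,dH\Big),\qquad f\in \mathrm{BM}_+(\Theta),$$ and a \emph{noncentral gamma random measure} $\mathrm{NcGaP}(H,M,c^{-1})$ if $$\mathrm E\, e^{-\int f\,dW}=\exp\Big(-\int_\Theta\log(1+cf)\,dH-\int_\Theta\frac{cf}{1+cf}\,dM\Big),\qquad f\in \mathrm{BM}_+(\Theta).$$ Let $(W_t)_{t\ge1}$ be a Markov process of locally finite random measures on $\Theta$ with random initial value $W_1$ such that, for every $t\ge 1$,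 the conditional law of $W_{t+1}$ given $W_1,\dots,W_t$ is $\mathrm{NcGaP}(H,\beta W_t,c^{-1})$. For each $t\ge1$ let $N_t$ be a random measure on $\mathbb Y$ which, given $W_t$, is a Poisson random measure with mean measure $\Lambda_t(dy)=\big(\int_\Theta K(y,\theta)\,W_t(d\theta)\big)\,\ell(dy)$. Assume that $\bar W_1=\mathrm E(W_1(\cdot))$ is locally finite and that, for every bounded measurable $B\subset\mathbb Y$, $$\int_B K(y,\theta)\,\ell(dy)<\infty\ \text{ for all }\theta\in\Theta,\qquad \int_B\int_\Theta K(y,\theta)\,[H+\bar W_1](d\theta)\,\ell(dy)<\infty .$$ Then there is a law $Q$ which is the law of a Poisson--gamma random field with rate $(1-\rho)/c$, that is, of a random measure $N_\infty$ such that, given $W_\infty\sim\mathrm{GaP}(H,(1-\rho)/c)$, $N_\infty$ is a Poisson random measure with mean measure $\big(\int_\Theta K(y,\theta)\,W_\infty(d\theta)\big)\,\ell(dy)$, and such that $Q$ is the limiting law of $(N_t)_{t\ge1}$ in the following sense: for every $f\in \mathrm{BM}_+(\mathbb Y)$, $$\lim_{t\to\infty}\mathrm E\,e^{-\int f\,dN_t}=\mathrm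 E\,e^{-\int f\,dN_\infty}=\exp\Big(-\int_\Theta\log\Big(1+\frac{c}{1-\rho}\int_{\mathbb Y}\big(1-e^{-f(y)}\big)K(y,\theta)\,\ell(dy)\Big)\,H(d\theta)\Big),$$ where all integrals in the last expression converge. Moreover, if $W_1\sim\mathrm{GaP}(H,(1-\rho)/c)$, then $N_t$ has law $Q$ for every $t\ge1$. -/

import Mathlib

open MeasureTheory ProbabilityTheory Filter Topology
open scoped ENNReal NNReal

noncomputable section

/-- A measure on a metric space is locally finite in the sense used for random measures when it
is finite on every set of bounded diameter. -/
def BoundedlyFinite {X : Type*} [MetricSpace X] [MeasurableSpace X] (μ : Measure X) : Prop :=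
  ∀ B : Set X, Bornology.IsBounded B → μ B < ∞

/-- The class `BM₊(X)`: nonnegative measurable bounded functions with bounded support. -/
structure IsBMPlus {X : Type*} [MetricSpace X] [MeasurableSpace X] (f : X → ℝ≥0) : Prop where
  measurable : Measurable f
  bounded : ∃ C : ℝ≥0, ∀ x, f x ≤ C
  bounded_support : Bornology.IsBounded (Function.support f)

/-- The function `x ↦ e^{-x}` on `[0, ∞]`, with `e^{-∞} = 0`. -/
def expNeg (x : ℝ≥0∞) : ℝ := if x = ∞ then 0 else Real.exp (-x.toReal)

/-- The Laplace functional `E(exp(-∫ f dW))` of a random measure `W` with law `Q`. The laws of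
random measures are probability measures on `Measure X`, whose `σ`-algebra is generated by the
evaluations `μ ↦ μ A` at measurable sets `A`. -/
def laplaceFunctional {X : Type*} [MeasurableSpace X] (Q : Measure (Measure X))
    (f : X → ℝ≥0) : ℝ :=
  ∫ μ, expNeg (∫⁻ x, (f x : ℝ≥0∞) ∂μ) ∂Q

/-- `Q` is the law of a gamma random measure with base measure `H` and rate `b`. -/
structure IsGammaLaw {X : Type*} [MetricSpace X] [MeasurableSpace X]
    (Q : Measure (Measure X)) (H : Measure X) (b : ℝ) : Prop where
  isProbabilityMeasure : IsProbabilityMeasure Q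
  ae_boundedlyFinite : ∀ᵐ μ ∂Q, BoundedlyFinite μ
  laplace_eq : ∀ f : X → ℝ≥0, IsBMPlus f →
    laplaceFunctional Q f = expNeg (∫⁻ x, ENNReal.ofReal (Real.log (1 + f x / b)) ∂H)

/-- `Q` is the law of a noncentral gamma random measure with parameters `(H, M, c⁻¹)`. -/
structure IsNoncentralGammaLaw {X : Type*} [MetricSpace X] [MeasurableSpace X]
    (Q : Measure (Measure X)) (H M : Measure X) (c : ℝ) : Prop where
  isProbabilityMeasure : IsProbabilityMeasure Q
  ae_boundedlyFinite : ∀ᵐ μ ∂Q, BoundedlyFinite μ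
  laplace_eq : ∀ f : X → ℝ≥0, IsBMPlus f →
    laplaceFunctional Q f =
      expNeg ((∫⁻ x, ENNReal.ofReal (Real.log (1 + c * f x)) ∂H)
        + ∫⁻ x, ENNReal.ofReal (c * f x / (1 + c * f x)) ∂M)

/-- The Poisson distribution on `{0, 1, 2, …} ∪ {∞}` with mean `m ∈ [0, ∞]`; for `m = ∞` it is
the point mass at `∞`. -/
def extendedPoisson (m : ℝ≥0∞) : Measure ℝ≥0∞ :=
  if m = ∞ then Measure.dirac ∞
  else (poissonMeasure m.toNNReal).map (fun n : ℕ => (n : ℝ≥0∞))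

/-- `Q` is the law of a Poisson random measure with mean measure `Λ`. -/
structure IsPoissonLaw {X : Type*} [MeasurableSpace X]
    (Q : Measure (Measure X)) (Λ : Measure X) : Prop where
  isProbabilityMeasure : IsProbabilityMeasure Q
  map_eval : ∀ A : Set X, MeasurableSet A → Q.map (fun μ => μ A) = extendedPoisson (Λ A)
  indep : ∀ (n : ℕ) (A : Fin n → Set X), (∀ i, MeasurableSet (A i)) →
    Pairwise (Function.onFun Disjoint A) → iIndepFun (fun i (μ : Measure X) => μ (A i)) Q

/-- The conditional law of `Y` given `X` satisfies `R`: there is a regular version `η` of this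
conditional law such that `R x (η x)` holds for almost every value `x` of `X`. -/
def CondLawSatisfies {Ω S T : Type*} [MeasurableSpace Ω] [MeasurableSpace S] [MeasurableSpace T]
    (P : Measure Ω) (X : Ω → S) (Y : Ω → T) (R : S → Measure T → Prop) : Prop :=
  ∃ η : Kernel S T, IsMarkovKernel η ∧ HasCondDistrib Y X η P ∧ ∀ᵐ x ∂(P.map X), R x (η x)

/-- `(W t)` for `t ≥ 1` is a measure-valued autoregressive gamma process of order one, with base
measure `H` and parameters `β t`, `c t` for `t ≥ 2`: a Markov process whose conditional law at
time `t + 1` given `W 1, …, W t` is noncentral gamma with parameters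
`(H, β (t + 1) W t, (c (t + 1))⁻¹)`. -/
structure IsMARG {Ω Θ : Type*} [MeasurableSpace Ω] [MetricSpace Θ] [MeasurableSpace Θ]
    (P : Measure Ω) (H : Measure Θ) (β c : ℕ → ℝ) (W : ℕ → Ω → Measure Θ) : Prop where
  measurable : ∀ t, 1 ≤ t → Measurable (W t)
  ae_boundedlyFinite : ∀ t, 1 ≤ t → ∀ᵐ ω ∂P, BoundedlyFinite (W t ω)
  transition : ∀ t (ht : 1 ≤ t),
    CondLawSatisfies P (fun ω (i : Finset.Icc 1 t) => W i ω) (W (t + 1))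
      (fun w Q => IsNoncentralGammaLaw Q H
        (ENNReal.ofReal (β (t + 1)) • w ⟨t, Finset.mem_Icc.2 ⟨ht, le_rfl⟩⟩) (c (t + 1)))

/-- The shot-noise intensity measure `Λ(dy) = k λ(y) ℓ(dy)` with `λ(y) = ∫ K(y, θ) w(dθ)`. -/
def shotNoiseIntensity {Θ 𝕐 : Type*} [MeasurableSpace Θ] [MeasurableSpace 𝕐]
    (k : ℝ≥0) (K : 𝕐 → Θ → ℝ≥0) (ℓ : Measure 𝕐) (w : Measure Θ) : Measure 𝕐 :=
  ℓ.withDensity (fun y => k * ∫⁻ θ, (K y θ : ℝ≥0∞) ∂w)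

/-- `(N t)` for `t ≥ 1` is a shot-noise measure-valued autoregressive gamma process of order one
driven by `(W t)`: given `W t`, `N t` is a Poisson random measure with mean measure
`κ t (∫ K(y, θ) W t (dθ)) ℓ(dy)`. -/
structure IsSNMARG {Ω Θ 𝕐 : Type*} [MeasurableSpace Ω] [MetricSpace Θ] [MeasurableSpace Θ]
    [MeasurableSpace 𝕐] (P : Measure Ω) (H : Measure Θ) (β c : ℕ → ℝ) (κ : ℕ → ℝ≥0)
    (K : 𝕐 → Θ → ℝ≥0) (ℓ : Measure 𝕐) (W : ℕ → Ω → Measure Θ) (N : ℕ → Ω → Measure 𝕐) :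
    Prop where
  isMARG : IsMARG P H β c W
  measurable : ∀ t, 1 ≤ t → Measurable (N t)
  observation : ∀ t, 1 ≤ t → CondLawSatisfies P (W t) (N t)
    (fun w Q => IsPoissonLaw Q (shotNoiseIntensity (κ t) K ℓ w))

/-- `Q` is the law of a Poisson-gamma random field `N` with base measure `H`, rate `b`, kernel `K`
and reference measure `ℓ`, where `J` is the joint law of `(W, N)`: `W` is a gamma random measure
with parameters `(H, b)` and, given `W`, `N` is a Poisson random measure with mean measure
`(∫ K(y, θ) W(dθ)) ℓ(dy)`. -/
def IsPoissonGammaFieldLaw {Θ 𝕐 : Type*} [MetricSpace Θ] [MeasurableSpace Θ] [MeasurableSpace 𝕐]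
    (Q : Measure (Measure 𝕐)) (H : Measure Θ) (b : ℝ) (K : 𝕐 → Θ → ℝ≥0) (ℓ : Measure 𝕐) : Prop :=
  ∃ J : Measure (Measure Θ × Measure 𝕐), IsProbabilityMeasure J ∧
    IsGammaLaw (J.map Prod.fst) H b ∧
    CondLawSatisfies J Prod.fst Prod.snd
      (fun w R => IsPoissonLaw R (shotNoiseIntensity 1 K ℓ w)) ∧
    J.map Prod.snd = Q

/-- The mean measure `A ↦ E(V(A))` of a random measure `V`. -/
def meanMeasure {Ω X : Type*} [MeasurableSpace Ω] [MeasurableSpace X] (P : Measure Ω)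
    (V : Ω → Measure X) : Measure X :=
  (P.map V).join

end

/-! Write ρ = βc. Integrating the noncentral gamma Laplace functional over its parameter `W t` shows
that the Laplace functional of `W (t + 1)` at f is exp(-∫ log(1 + cf) dH) times that of `W t` at
ρf/(1 + cf) (`IsMARG.laplace_succ`). Maps a ↦ ra/(1 + ka) are closed under composition, and the
logarithms add up along it (`mobius_mobius`, `logOneAdd_add_mobius`). So t steps from `W 1` give
exp(-∫ log(1 + k_t f) dH) times the Laplace functional of `W 1` at ρ^t f/(1 + k_t f), where k_t =
c(1 + ρ + ... + ρ^(t-1)) (`IsMARG.laplace_add`). Since ρ < 1, k_t increases to c/(1 - ρ). The second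
factor tends to 1 when ∫ f dW_1 has finite mean, because the integral in its exponent is at most ρ^t
∫ f dW_1 (`IsMARG.tendsto_laplace`). The limit is the gamma functional with rate (1 - ρ)/c, and c/(1
- ρ) is the fixed point of k ↦ c + ρk, which gives stationarity.

Conditioning on `W t` turns the Laplace functional of `N t` at f into that of `W t` at h(θ) = ∫ (1 -
e^{-f(y)}) K(y, θ) ℓ(dy) (`laplaceFunctional_shotNoise`). This h is finite but need not be bounded
or have bounded support, so all Laplace formulas are first extended from BM₊ to every measurable
function with values in [0, ∞) by monotone limits. The hypotheses on K and Tonelli make h integrable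
for H and for the mean of `W 1`. Equality of laws in the stationary case uses that Laplace
functionals determine laws (`ext_of_laplaceFunctional`).

The law Q must also be constructed. Poisson measures with finite mean are mixtures of i.i.d.
samples, and the s-finite case is an independent superposition. Gamma measures are compound Poisson,
with Frullani's integral giving the logarithm. A Poisson law depending measurably on its intensity
comes from thinning one Poisson measure on Y × (0, ∞) under the graph of the density
(`exists_kernel_isPoissonLaw`). -/

/-! ### The exponential e^{-x} on [0, ∞]. -/

theorem expNeg_top : expNeg ∞ = 0 := by simp [expNeg]

theorem expNeg_zero : expNeg 0 = 1 := by simp [expNeg]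

theorem expNeg_of_ne_top {x : ℝ≥0∞} (hx : x ≠ ∞) : expNeg x = Real.exp (-x.toReal) := by
  simp [expNeg, hx]

theorem expNeg_coe (x : ℝ≥0) : expNeg x = Real.exp (-(x : ℝ)) := by simp [expNeg]

theorem expNeg_ofReal {x : ℝ} (hx : 0 ≤ x) : expNeg (ENNReal.ofReal x) = Real.exp (-x) := by
  simp [expNeg, hx]

theorem expNeg_nonneg (x : ℝ≥0∞) : 0 ≤ expNeg x := by
  unfold expNeg; split_ifs <;> positivity

theorem expNeg_le_one (x : ℝ≥0∞) : expNeg x ≤ 1 := by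
  unfold expNeg; split_ifs <;> simp

theorem norm_expNeg_le (x : ℝ≥0∞) : ‖expNeg x‖ ≤ 1 := by
  rw [Real.norm_of_nonneg (expNeg_nonneg x)]; exact expNeg_le_one x

theorem expNeg_pos {x : ℝ≥0∞} (hx : x ≠ ∞) : 0 < expNeg x := by
  rw [expNeg_of_ne_top hx]; positivity

theorem expNeg_add (x y : ℝ≥0∞) : expNeg (x + y) = expNeg x * expNeg y := by
  by_cases hx : x = ∞
  · simp [hx, expNeg_top]
  by_cases hy : y = ∞
  · simp [hy, expNeg_top]
  rw [expNeg_of_ne_top hx, expNeg_of_ne_top hy, expNeg_of_ne_top (by simp [hx, hy]),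
    ENNReal.toReal_add hx hy, ← Real.exp_add]
  congr 1; ring

theorem expNeg_sum {ι : Type*} (s : Finset ι) (x : ι → ℝ≥0∞) :
    expNeg (∑ i ∈ s, x i) = ∏ i ∈ s, expNeg (x i) := by
  classical
  induction s using Finset.induction_on with
  | empty => simp [expNeg_zero]
  | insert a s ha ih => rw [Finset.sum_insert ha, Finset.prod_insert ha, expNeg_add, ih]

theorem expNeg_nat_mul (n : ℕ) (x : ℝ≥0∞) : expNeg (n * x) = expNeg x ^ n := by
  simpa using expNeg_sum (Finset.range n) (fun _ => x)

/-- Reduces continuity, including at ∞, to that of the extended exponential. -/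
theorem expNeg_eq_toReal_exp (x : ℝ≥0∞) : expNeg x = (EReal.exp (-(x : EReal))).toReal := by
  induction x with
  | top => simp [expNeg_top]
  | coe x =>
    rw [expNeg_coe, show (-(((x : ℝ≥0∞)) : EReal)) = ((-(x : ℝ) : ℝ) : EReal) from rfl,
      EReal.exp_coe, ENNReal.toReal_ofReal (by positivity)]

theorem continuous_expNeg : Continuous expNeg := by
  have h : expNeg = fun x : ℝ≥0∞ => (EReal.exp (-(x : EReal))).toReal :=
    funext expNeg_eq_toReal_exp
  rw [h]
  refine continuous_iff_continuousAt.2 fun x => ?_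
  refine (ENNReal.tendsto_toReal ?_).comp ?_
  · rw [Ne, EReal.exp_eq_top_iff]
    intro h'
    simp at h'
  · exact (ENNReal.continuous_exp.comp
      (continuous_neg.comp continuous_coe_ennreal_ereal)).continuousAt

theorem measurable_expNeg : Measurable expNeg := continuous_expNeg.measurable

theorem expNeg_injective : Function.Injective expNeg := by
  intro x y h
  by_cases hx : x = ∞
  · by_contra hxy
    have := expNeg_pos (x := y) (fun h' => hxy (hx.trans h'.symm))
    rw [← h, hx, expNeg_top] at this
    exact lt_irrefl _ this
  by_cases hy : y = ∞
  · have := expNeg_pos hx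
    rw [h, hy, expNeg_top] at this
    exact absurd this (lt_irrefl _)
  rw [expNeg_of_ne_top hx, expNeg_of_ne_top hy, Real.exp_eq_exp, neg_inj] at h
  exact (ENNReal.toReal_eq_toReal_iff' hx hy).1 h

theorem integrable_expNeg {Ω : Type*} [MeasurableSpace Ω] {P : Measure Ω} [IsFiniteMeasure P]
    {g : Ω → ℝ≥0∞} (hg : AEMeasurable g P) : Integrable (fun ω => expNeg (g ω)) P :=
  Integrable.of_bound (measurable_expNeg.comp_aemeasurable hg).aestronglyMeasurable 1
    (ae_of_all _ fun _ => norm_expNeg_le _)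

/-! ### Laplace functionals determine laws of random measures. -/

/-- The bounded continuous function `x ↦ e^{-x i}` on `[0, ∞]^ι`. -/
noncomputable def coordExpNeg {ι : Type*} (i : ι) : BoundedContinuousFunction (ι → ℝ≥0∞) ℝ :=
  BoundedContinuousFunction.ofNormedAddCommGroup (fun x => expNeg (x i))
    (continuous_expNeg.comp (continuous_apply i)) 1 (fun _ => norm_expNeg_le _)

theorem coordExpNeg_apply {ι : Type*} (i : ι) (x : ι → ℝ≥0∞) :
    coordExpNeg i x = expNeg (x i) := rfl

/-- A finite measure on `[0, ∞]^ι` is determined by its Laplace transform at integer points. -/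
theorem ext_of_integral_expNeg {ι : Type*} [Fintype ι] {μ ν : Measure (ι → ℝ≥0∞)}
    [IsFiniteMeasure μ] [IsFiniteMeasure ν]
    (h : ∀ k : ι → ℕ, ∫ x, expNeg (∑ i, k i * x i) ∂μ = ∫ x, expNeg (∑ i, k i * x i) ∂ν) :
    μ = ν := by
  classical
  let s : Set (BoundedContinuousFunction (ι → ℝ≥0∞) ℝ) := Set.range coordExpNeg
  let A : StarSubalgebra ℝ (BoundedContinuousFunction (ι → ℝ≥0∞) ℝ) :=
    { Algebra.adjoin ℝ s with
      star_mem' := fun {a} ha => by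
        have : star a = a := by ext x; simp
        rw [this]; exact ha }
  have hmem : ∀ i, coordExpNeg i ∈ A := fun i => Algebra.subset_adjoin ⟨i, rfl⟩
  -- Stone–Weierstrass: the algebra generated by the coordinate exponentials separates points, so
  -- its integrals determine the measure. It is spanned by monomials, and a monomial is e^{-∑ k_i
  -- x_i} with natural exponents.
  refine ext_of_forall_mem_subalgebra_integral_eq_of_polish (𝕜 := ℝ) (A := A) ?_ ?_
  · intro x y hxy
    obtain ⟨i, hi⟩ := Function.ne_iff.1 hxy
    exact ⟨_, ⟨_, ⟨coordExpNeg i, hmem i, rfl⟩, rfl⟩, fun h' => hi (expNeg_injective h')⟩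
  · intro g hg
    have hg' : g ∈ Submodule.span ℝ (Submonoid.closure s : Set _) := by
      rw [← Algebra.adjoin_eq_span]; exact hg
    have hmon : ∀ g ∈ Submonoid.closure s, ∃ k : ι → ℕ, ∀ x, g x = expNeg (∑ i, k i * x i) := by
      intro g hg
      induction hg using Submonoid.closure_induction with
      | mem g hg =>
        obtain ⟨i, rfl⟩ := hg
        refine ⟨Pi.single i 1, fun x => ?_⟩
        rw [Finset.sum_eq_single i (fun j _ hj => by simp [hj]) (by simp)]
        simp [coordExpNeg_apply]
      | one => exact ⟨0, fun x => by simp [expNeg_zero]⟩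
      | mul a b _ _ iha ihb =>
        obtain ⟨k, hk⟩ := iha
        obtain ⟨l, hl⟩ := ihb
        refine ⟨k + l, fun x => ?_⟩
        simp only [BoundedContinuousFunction.coe_mul, Pi.mul_apply, hk, hl, ← expNeg_add,
          ← Finset.sum_add_distrib, Pi.add_apply, Nat.cast_add, add_mul]
    clear hg
    induction hg' using Submodule.span_induction with
    | mem g hg =>
      obtain ⟨k, hk⟩ := hmon g hg
      simp_rw [hk]; exact h k
    | zero => simp
    | add a b ha hb iha ihb =>
      simp only [BoundedContinuousFunction.coe_add, Pi.add_apply]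
      rw [integral_add (a.integrable μ) (b.integrable μ),
        integral_add (a.integrable ν) (b.integrable ν), iha, ihb]
    | smul r a ha iha =>
      simp only [BoundedContinuousFunction.coe_smul]
      rw [integral_smul, integral_smul, iha]

/-- Evaluation of a measure at all measurable sets. -/
noncomputable def evalMeasurable (X : Type*) [MeasurableSpace X] (μ : Measure X) :
    {A : Set X // MeasurableSet A} → ℝ≥0∞ := fun A => μ A

theorem measurable_evalMeasurable (X : Type*) [MeasurableSpace X] :
    Measurable (evalMeasurable X) :=
  measurable_pi_lambda _ fun A => Measure.measurable_coe A.2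

/-- Allows laws on `Measure X` to be compared after pushing them to a product of copies of [0, ∞],
where finite-dimensional distributions suffice. -/
theorem comap_evalMeasurable (X : Type*) [MeasurableSpace X] :
    MeasurableSpace.comap (evalMeasurable X) MeasurableSpace.pi
      = (inferInstance : MeasurableSpace (Measure X)) := by
  refine le_antisymm (measurable_evalMeasurable X).comap_le ?_
  refine iSup_le fun A => iSup_le fun hA => ?_
  rintro _ ⟨B, hB, rfl⟩
  exact ⟨(fun x => x ⟨A, hA⟩) ⁻¹' B, measurable_pi_apply _ hB, rfl⟩

theorem lintegral_sum_indicator {X ι : Type*} [MeasurableSpace X] [Fintype ι] (μ : Measure X)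
    (A : ι → Set X) (hA : ∀ i, MeasurableSet (A i)) (k : ι → ℝ≥0) :
    ∫⁻ x, ((∑ i, (A i).indicator (fun _ => k i) x : ℝ≥0) : ℝ≥0∞) ∂μ
      = ∑ i, (k i : ℝ≥0∞) * μ (A i) := by
  simp only [ENNReal.ofNNReal_finsetSum, ENNReal.coe_indicator]
  rw [lintegral_finsetSum _ fun i _ => measurable_const.indicator (hA i)]
  simp [hA]

theorem measurable_sum_indicator {X ι : Type*} [MeasurableSpace X] [Fintype ι]
    {A : ι → Set X} (hA : ∀ i, MeasurableSet (A i)) (k : ι → ℝ≥0) :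
    Measurable fun x => ∑ i, (A i).indicator (fun _ => k i) x :=
  Finset.measurable_sum _ fun i _ => measurable_const.indicator (hA i)

/-- The law of a random measure is determined by its Laplace functional. -/
theorem ext_of_laplaceFunctional {X : Type*} [MeasurableSpace X] {Q R : Measure (Measure X)}
    [IsProbabilityMeasure Q] [IsProbabilityMeasure R]
    (h : ∀ f : X → ℝ≥0, Measurable f → laplaceFunctional Q f = laplaceFunctional R f) :
    Q = R := by
  have hev := measurable_evalMeasurable X
  have hres : ∀ I : Finset {A : Set X // MeasurableSet A},
      (Q.map (evalMeasurable X)).map I.restrict = (R.map (evalMeasurable X)).map I.restrict := by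
    intro I
    have hI : Measurable (I.restrict (π := fun _ => ℝ≥0∞)) := Finset.measurable_restrict I
    have : IsProbabilityMeasure (Q.map (evalMeasurable X)) :=
      Measure.isProbabilityMeasure_map hev.aemeasurable
    have : IsProbabilityMeasure (R.map (evalMeasurable X)) :=
      Measure.isProbabilityMeasure_map hev.aemeasurable
    have := Measure.isProbabilityMeasure_map (μ := Q.map (evalMeasurable X)) hI.aemeasurable
    have := Measure.isProbabilityMeasure_map (μ := R.map (evalMeasurable X)) hI.aemeasurable
    refine ext_of_integral_expNeg fun k => ?_
    have hm : Measurable fun x : I → ℝ≥0∞ => expNeg (∑ i, k i * x i) :=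
      measurable_expNeg.comp (Finset.measurable_sum _ fun i _ =>
        (measurable_pi_apply i).const_mul _)
    have key : ∀ S : Measure (Measure X),
        ∫ x, expNeg (∑ i, k i * x i) ∂((S.map (evalMeasurable X)).map I.restrict)
          = laplaceFunctional S
            (fun x => ∑ i : I, (i.1.1).indicator (fun _ => (k i : ℝ≥0)) x) := by
      intro S
      rw [integral_map hI.aemeasurable hm.aestronglyMeasurable,
        integral_map hev.aemeasurable (f := fun x => expNeg (∑ i, k i * I.restrict x i))
          (hm.comp hI).aestronglyMeasurable, laplaceFunctional]
      refine integral_congr_ae (ae_of_all _ fun μ => ?_)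
      simp only
      rw [lintegral_sum_indicator μ (fun i : I => i.1.1) (fun i => i.1.2)]
      simp [evalMeasurable]
    rw [key, key]
    exact h _ (measurable_sum_indicator (fun i : I => i.1.2) _)
  -- Two finite measures on the product with the same finite-dimensional marginals are projective
  -- limits of one family, hence equal.
  have hmap : Q.map (evalMeasurable X) = R.map (evalMeasurable X) := by
    have : IsProbabilityMeasure (Q.map (evalMeasurable X)) :=
      Measure.isProbabilityMeasure_map hev.aemeasurable
    have : ∀ I : Finset {A : Set X // MeasurableSet A},
      IsFiniteMeasure ((Q.map (evalMeasurable X)).map I.restrict) := fun I => inferInstance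
    exact IsProjectiveLimit.unique (fun I => rfl) (fun I => (hres I).symm)
  ext S hS
  obtain ⟨T, hT, rfl⟩ : MeasurableSet[MeasurableSpace.comap (evalMeasurable X)
    MeasurableSpace.pi] S := by rw [comap_evalMeasurable X]; exact hS
  rw [← Measure.map_apply hev hT, ← Measure.map_apply hev hT, hmap]

theorem measurable_laplace_integrand {X : Type*} [MeasurableSpace X] {f : X → ℝ≥0}
    (hf : Measurable f) : Measurable fun μ : Measure X => expNeg (∫⁻ x, (f x : ℝ≥0∞) ∂μ) :=
  measurable_expNeg.comp (Measure.measurable_lintegral hf.coe_nnreal_ennreal)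

/-- Monotone approximation of a measurable function passes to Laplace functionals. -/
theorem tendsto_laplaceFunctional {X : Type*} [MeasurableSpace X] (Q : Measure (Measure X))
    [IsFiniteMeasure Q] {f : ℕ → X → ℝ≥0} {g : X → ℝ≥0} (hf : ∀ n, Measurable (f n))
    (hmono : Monotone f) (hlim : ∀ x, Tendsto (fun n => f n x) atTop (𝓝 (g x))) :
    Tendsto (fun n => laplaceFunctional Q (f n)) atTop (𝓝 (laplaceFunctional Q g)) := by
  refine tendsto_integral_of_dominated_convergence (fun _ => 1)
    (fun n => (measurable_laplace_integrand (hf n)).aestronglyMeasurable)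
    (integrable_const _) (fun n => ae_of_all _ fun μ => norm_expNeg_le _)
    (ae_of_all _ fun μ => ?_)
  refine (continuous_expNeg.tendsto _).comp ?_
  refine lintegral_tendsto_of_tendsto_of_monotone
    (fun n => (hf n).coe_nnreal_ennreal.aemeasurable)
    (ae_of_all _ fun x n m hnm => ENNReal.coe_le_coe.2 (hmono hnm x))
    (ae_of_all _ fun x => ENNReal.tendsto_coe.2 (hlim x))

/-! ### Laplace functionals of Poisson random measures. -/

/-- The function `a ↦ 1 - e^{-a}` from `[0, ∞)` to `[0, ∞]`. -/
noncomputable def oneSubExp (a : ℝ≥0) : ℝ≥0∞ := ENNReal.ofReal (1 - Real.exp (-(a : ℝ)))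

theorem continuous_oneSubExp : Continuous oneSubExp := by
  unfold oneSubExp
  exact ENNReal.continuous_ofReal.comp (by fun_prop)

theorem oneSubExp_mono : Monotone oneSubExp := fun a b h => by
  unfold oneSubExp
  gcongr

theorem oneSubExp_zero : oneSubExp 0 = 0 := by simp [oneSubExp]

theorem oneSubExp_ne_zero {a : ℝ≥0} (ha : a ≠ 0) : oneSubExp a ≠ 0 := by
  have : 0 < a := pos_iff_ne_zero.2 ha
  simp [oneSubExp, this]

/-- Monotone convergence for the explicit side of each Laplace formula. It is paired with
`tendsto_laplaceFunctional` to extend a formula from simple or BM₊ functions to all measurable ones.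
-/
theorem tendsto_expNeg_lintegral_of_monotone {X : Type*} [MeasurableSpace X] (Λ : Measure X)
    {F : ℝ≥0 → ℝ≥0∞} (hF : Continuous F) (hFm : Monotone F)
    {f : ℕ → X → ℝ≥0} {g : X → ℝ≥0} (hf : ∀ n, Measurable (f n))
    (hmono : Monotone f) (hlim : ∀ x, Tendsto (fun n => f n x) atTop (𝓝 (g x))) :
    Tendsto (fun n => expNeg (∫⁻ x, F (f n x) ∂Λ)) atTop (𝓝 (expNeg (∫⁻ x, F (g x) ∂Λ))) := by
  refine (continuous_expNeg.tendsto _).comp ?_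
  exact lintegral_tendsto_of_tendsto_of_monotone
    (fun n => (hF.measurable.comp (hf n)).aemeasurable)
    (ae_of_all _ fun x n m hnm => hFm (hmono hnm x))
    (ae_of_all _ fun x => (hF.tendsto _).comp (hlim x))

theorem exists_simpleFunc_monotone_tendsto {X : Type*} [MeasurableSpace X] {f : X → ℝ≥0}
    (hf : Measurable f) : ∃ g : ℕ → SimpleFunc X ℝ≥0, Monotone (fun n => (g n : X → ℝ≥0)) ∧
      ∀ x, Tendsto (fun n => g n x) atTop (𝓝 (f x)) := by
  have hfe : Measurable fun x => (f x : ℝ≥0∞) := hf.coe_nnreal_ennreal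
  have hle : ∀ n x, SimpleFunc.eapprox (fun x => (f x : ℝ≥0∞)) n x ≠ ∞ := fun n x =>
    (SimpleFunc.eapprox_lt_top _ n x).ne
  refine ⟨fun n => (SimpleFunc.eapprox (fun x => (f x : ℝ≥0∞)) n).map ENNReal.toNNReal, ?_, ?_⟩
  · intro n m hnm x
    simp only [SimpleFunc.coe_map, Function.comp]
    exact ENNReal.toNNReal_mono (hle m x) (SimpleFunc.monotone_eapprox _ hnm x)
  · intro x
    have := (ENNReal.tendsto_toNNReal (a := (f x : ℝ≥0∞)) ENNReal.coe_ne_top).comp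
      (SimpleFunc.tendsto_eapprox hfe x)
    simpa [Function.comp_def] using this

/-- A nonnegative simple function is a combination of indicators of disjoint sets. -/
theorem exists_sum_indicator_of_simpleFunc {X : Type*} [MeasurableSpace X] (f : SimpleFunc X ℝ≥0) :
    ∃ (n : ℕ) (A : Fin n → Set X) (a : Fin n → ℝ≥0), (∀ i, MeasurableSet (A i)) ∧
      Pairwise (Function.onFun Disjoint A) ∧
      (f : X → ℝ≥0) = fun x => ∑ i, (A i).indicator (fun _ => a i) x := by
  let e := f.range.equivFin
  refine ⟨f.range.card, fun i => f ⁻¹' {((e.symm i : f.range) : ℝ≥0)}, fun i => e.symm i,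
    fun i => f.measurableSet_fiber _, ?_, ?_⟩
  · intro i j hij
    refine Set.disjoint_left.2 fun x hx hx' => hij (e.symm.injective (Subtype.ext ?_))
    exact (Set.mem_singleton_iff.1 hx).symm.trans (Set.mem_singleton_iff.1 hx')
  · ext1 x
    let j : f.range := ⟨f x, f.mem_range_self x⟩
    rw [Finset.sum_eq_single (e j)]
    · simp [j]
    · intro i _ hi
      refine Set.indicator_of_notMem (fun hx => hi ?_) _
      have : j = e.symm i := Subtype.ext hx
      rw [this, Equiv.apply_symm_apply]
    · simp

/-- A function of a combination of indicators of disjoint sets, applied to it. -/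
theorem comp_sum_indicator_disjoint {X : Type*} {n : ℕ} {A : Fin n → Set X}
    (hd : Pairwise (Function.onFun Disjoint A)) (a : Fin n → ℝ≥0) {F : ℝ≥0 → ℝ≥0∞}
    (hF : F 0 = 0) (x : X) :
    F (∑ i, (A i).indicator (fun _ => a i) x) = ∑ i, (A i).indicator (fun _ => F (a i)) x := by
  by_cases h : ∃ i, x ∈ A i
  · obtain ⟨i, hi⟩ := h
    have hj : ∀ j, j ≠ i → x ∉ A j := fun j hj hxj =>
      Set.disjoint_left.1 (hd hj) hxj hi
    rw [Finset.sum_eq_single i (fun j _ h => by simp [hj j h]) (by simp),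
      Finset.sum_eq_single i (fun j _ h => by simp [hj j h]) (by simp)]
    simp [hi]
  · push Not at h
    simp [h, hF]

theorem lintegral_comp_sum_indicator {X : Type*} [MeasurableSpace X] (Λ : Measure X) {n : ℕ}
    {A : Fin n → Set X} (hA : ∀ i, MeasurableSet (A i))
    (hd : Pairwise (Function.onFun Disjoint A)) (a : Fin n → ℝ≥0) {F : ℝ≥0 → ℝ≥0∞}
    (hF : F 0 = 0) :
    ∫⁻ x, F (∑ i, (A i).indicator (fun _ => a i) x) ∂Λ = ∑ i, F (a i) * Λ (A i) := by
  simp_rw [comp_sum_indicator_disjoint hd a hF]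
  rw [lintegral_finsetSum _ fun i _ => measurable_const.indicator (hA i)]
  simp [hA]

instance isProbabilityMeasure_extendedPoisson (m : ℝ≥0∞) :
    IsProbabilityMeasure (extendedPoisson m) := by
  unfold extendedPoisson
  split_ifs
  · infer_instance
  · exact Measure.isProbabilityMeasure_map (by fun_prop)

/-- The Laplace transform of the Poisson distribution on `[0, ∞]`. -/
theorem integral_expNeg_extendedPoisson (m : ℝ≥0∞) (a : ℝ≥0) :
    ∫ x, expNeg (a * x) ∂(extendedPoisson m) = expNeg (oneSubExp a * m) := by
  have hm : Measurable fun x : ℝ≥0∞ => expNeg (a * x) :=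
    measurable_expNeg.comp (measurable_id.const_mul _)
  unfold extendedPoisson
  split_ifs with h
  · rw [integral_dirac]
    -- For infinite mean both sides are 1 at a = 0, by the convention 0 · ∞ = 0, and both are 0
    -- otherwise.
    by_cases ha : a = 0
    · simp [ha, oneSubExp_zero]
    · rw [h, ENNReal.mul_top (by simpa using ha), ENNReal.mul_top (oneSubExp_ne_zero ha)]
  · lift m to ℝ≥0 using h
    rw [integral_map (by fun_prop) hm.aestronglyMeasurable, ENNReal.toNNReal_coe,
      integral_poissonMeasure']
    · have h1 : ∀ n : ℕ, expNeg (a * (n : ℝ≥0∞)) = Real.exp (-(a : ℝ)) ^ n := by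
        intro n
        rw [mul_comm, expNeg_nat_mul, expNeg_coe]
      have h2 : oneSubExp a * (m : ℝ≥0∞)
          = ENNReal.ofReal ((1 - Real.exp (-(a : ℝ))) * m) := by
        rw [oneSubExp, ENNReal.ofReal_mul (by simp), ENNReal.ofReal_coe_nnreal]
      rw [h2, expNeg_ofReal (x := (1 - Real.exp (-(a : ℝ))) * m)
        (mul_nonneg (sub_nonneg.2 (Real.exp_le_one_iff.2 (by simp))) m.2)]
      simp_rw [h1, smul_eq_mul]
      have h3 : ∀ n : ℕ, Real.exp (-(m : ℝ)) * (m : ℝ) ^ n / (n.factorial : ℝ)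
          * Real.exp (-(a : ℝ)) ^ n
          = Real.exp (-(m : ℝ)) * ((m * Real.exp (-(a : ℝ))) ^ n / (n.factorial : ℝ)) := by
        intro n; rw [mul_pow]; ring
      simp_rw [h3]
      rw [tsum_mul_left, ← NormedSpace.exp_eq_tsum_div (𝔸 := ℝ) |> fun h => congrFun h _,
        ← Real.exp_eq_exp_ℝ, ← Real.exp_add]
      congr 1; ring
    · exact integrable_expNeg (by fun_prop)

/-- Independence over disjoint sets factorises the expectation into one-dimensional Poisson
transforms. -/
theorem IsPoissonLaw.laplace_sum_indicator {X : Type*} [MeasurableSpace X]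
    {Q : Measure (Measure X)} {Λ : Measure X} (h : IsPoissonLaw Q Λ) {n : ℕ}
    {A : Fin n → Set X} (hA : ∀ i, MeasurableSet (A i))
    (hd : Pairwise (Function.onFun Disjoint A)) (a : Fin n → ℝ≥0) :
    laplaceFunctional Q (fun x => ∑ i, (A i).indicator (fun _ => a i) x)
      = expNeg (∑ i, oneSubExp (a i) * Λ (A i)) := by
  have := h.isProbabilityMeasure
  unfold laplaceFunctional
  simp_rw [lintegral_sum_indicator _ A hA a, expNeg_sum]
  have hm : ∀ i, Measurable fun x : ℝ≥0∞ => expNeg (a i * x) := fun i =>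
    measurable_expNeg.comp (measurable_id.const_mul _)
  rw [(h.indep n A hA hd).integral_fun_prod_comp (f := fun i x => expNeg (a i * x))
    (fun i => (Measure.measurable_coe (hA i)).aemeasurable)
    (fun i => (hm i).aestronglyMeasurable)]
  refine Finset.prod_congr rfl fun i _ => ?_
  rw [← integral_expNeg_extendedPoisson, ← h.map_eval _ (hA i),
    integral_map (Measure.measurable_coe (hA i)).aemeasurable (hm i).aestronglyMeasurable]

/-- The Laplace functional of a Poisson random measure. -/
theorem IsPoissonLaw.laplace_eq {X : Type*} [MeasurableSpace X]
    {Q : Measure (Measure X)} {Λ : Measure X} (h : IsPoissonLaw Q Λ) {f : X → ℝ≥0}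
    (hf : Measurable f) :
    laplaceFunctional Q f = expNeg (∫⁻ x, oneSubExp (f x) ∂Λ) := by
  have := h.isProbabilityMeasure
  obtain ⟨g, hmono, hlim⟩ := exists_simpleFunc_monotone_tendsto hf
  refine tendsto_nhds_unique
    (tendsto_laplaceFunctional Q (fun n => (g n).measurable) hmono hlim) ?_
  have key : ∀ n, laplaceFunctional Q (g n) = expNeg (∫⁻ x, oneSubExp (g n x) ∂Λ) := by
    intro n
    obtain ⟨k, A, a, hA, hd, he⟩ := exists_sum_indicator_of_simpleFunc (g n)
    rw [he, h.laplace_sum_indicator hA hd, lintegral_comp_sum_indicator Λ hA hd a oneSubExp_zero]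
  simp_rw [key]
  exact tendsto_expNeg_lintegral_of_monotone Λ continuous_oneSubExp oneSubExp_mono
    (fun n => (g n).measurable) hmono hlim

theorem IsPoissonLaw.unique {X : Type*} [MeasurableSpace X]
    {Q R : Measure (Measure X)} {Λ : Measure X} (hQ : IsPoissonLaw Q Λ) (hR : IsPoissonLaw R Λ) :
    Q = R := by
  have := hQ.isProbabilityMeasure
  have := hR.isProbabilityMeasure
  exact ext_of_laplaceFunctional fun f hf => by rw [hQ.laplace_eq hf, hR.laplace_eq hf]

/-- A random measure with the Laplace functional of a Poisson random measure is Poisson. -/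
theorem isPoissonLaw_of_laplace {X : Type*} [MeasurableSpace X]
    {Q : Measure (Measure X)} {Λ : Measure X} [IsProbabilityMeasure Q]
    (h : ∀ f : X → ℝ≥0, Measurable f →
      laplaceFunctional Q f = expNeg (∫⁻ x, oneSubExp (f x) ∂Λ)) : IsPoissonLaw Q Λ := by
  -- Testing against step functions with integer coefficients identifies the joint law on disjoint
  -- sets as a product; this yields both the Poisson marginals (n = 1) and the independence.
  have joint : ∀ (n : ℕ) (A : Fin n → Set X), (∀ i, MeasurableSet (A i)) →
      Pairwise (Function.onFun Disjoint A) →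
      Q.map (fun μ i => μ (A i)) = Measure.pi fun i => extendedPoisson (Λ (A i)) := by
    intro n A hA hd
    have hmeas : Measurable fun (μ : Measure X) i => μ (A i) :=
      measurable_pi_lambda _ fun i => Measure.measurable_coe (hA i)
    have := Measure.isProbabilityMeasure_map (μ := Q) hmeas.aemeasurable
    refine ext_of_integral_expNeg fun k => ?_
    have hm : Measurable fun x : Fin n → ℝ≥0∞ => expNeg (∑ i, k i * x i) :=
      measurable_expNeg.comp (Finset.measurable_sum _ fun i _ =>
        (measurable_pi_apply i).const_mul _)
    rw [integral_map hmeas.aemeasurable hm.aestronglyMeasurable]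
    have h1 := h _ (measurable_sum_indicator hA fun i => (k i : ℝ≥0))
    rw [lintegral_comp_sum_indicator Λ hA hd _ oneSubExp_zero, laplaceFunctional] at h1
    simp_rw [lintegral_sum_indicator _ A hA (fun i => (k i : ℝ≥0)), ENNReal.coe_natCast] at h1
    rw [h1]
    simp_rw [expNeg_sum]
    rw [integral_fintype_prod_eq_prod (fun i x => expNeg (k i * x))]
    refine Finset.prod_congr rfl fun i _ => ?_
    rw [← integral_expNeg_extendedPoisson, ENNReal.coe_natCast]
  have single : ∀ A : Set X, MeasurableSet A →
      Q.map (fun μ => μ A) = extendedPoisson (Λ A) := by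
    intro A hA
    have h1 := joint 1 (fun _ => A) (fun _ => hA) (fun i j hij =>
      (hij (Subsingleton.elim i j)).elim)
    have h2 := congrArg (Measure.map (fun x : Fin 1 → ℝ≥0∞ => x 0)) h1
    rw [Measure.map_map (measurable_pi_apply 0)
      (measurable_pi_lambda _ fun i => Measure.measurable_coe hA)] at h2
    rw [(measurePreserving_eval (fun _ : Fin 1 => extendedPoisson (Λ A)) 0).map_eq] at h2
    exact h2
  refine ⟨inferInstance, single, fun n A hA hd => ?_⟩
  rw [iIndepFun_iff_map_fun_eq_pi_map fun i => (Measure.measurable_coe (hA i)).aemeasurable,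
    joint n A hA hd]
  simp_rw [single _ (hA _)]

/-! ### Construction of Poisson random measures. -/

theorem measurable_sum_dirac {X : Type*} [MeasurableSpace X] (k : ℕ) :
    Measurable fun x : Fin k → X => ∑ i, Measure.dirac (x i) := by
  refine Measure.measurable_of_measurable_coe _ fun s hs => ?_
  simp only [Measure.coe_finsetSum, Finset.sum_apply]
  exact Finset.measurable_sum _ fun i _ =>
    (Measure.measurable_coe hs).comp (Measure.measurable_dirac.comp (measurable_pi_apply i))

/-- The law of the Poisson random measure with finite mean measure `Λ`: given that there are `k`
points, these are independent with distribution proportional to `Λ`. -/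
noncomputable def finitePoissonLaw {X : Type*} [MeasurableSpace X] (Λ : Measure X) :
    Measure (Measure X) :=
  Measure.sum fun k : ℕ => ENNReal.ofReal (Real.exp (-Λ.real Set.univ) / k.factorial) •
    (Measure.pi fun _ : Fin k => Λ).map fun x => ∑ i, Measure.dirac (x i)

/-- With l the total mass of the mean measure, x = l gives total probability 1, and x = ∫ e^{-f} dΛ
gives the Laplace functional. -/
theorem hasSum_exp_mul_pow (l x : ℝ) :
    HasSum (fun k : ℕ => Real.exp (-l) / k.factorial * x ^ k) (Real.exp (-l + x)) := by
  rw [Real.exp_add]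
  have h := NormedSpace.expSeries_div_hasSum_exp (𝔸 := ℝ) x
  rw [← Real.exp_eq_exp_ℝ] at h
  have h2 := h.mul_left (Real.exp (-l))
  refine h2.congr_fun fun k => by ring

theorem isProbabilityMeasure_finitePoissonLaw {X : Type*} [MeasurableSpace X] (Λ : Measure X)
    [IsFiniteMeasure Λ] : IsProbabilityMeasure (finitePoissonLaw Λ) := by
  refine ⟨?_⟩
  rw [finitePoissonLaw, Measure.sum_apply _ MeasurableSet.univ]
  have h : ∀ k : ℕ, (ENNReal.ofReal (Real.exp (-Λ.real Set.univ) / k.factorial) •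
      (Measure.pi fun _ : Fin k => Λ).map fun x => ∑ i, Measure.dirac (x i)) Set.univ
      = ENNReal.ofReal (Real.exp (-Λ.real Set.univ) / k.factorial * Λ.real Set.univ ^ k) := by
    intro k
    rw [Measure.smul_apply, Measure.map_apply (measurable_sum_dirac k) MeasurableSet.univ,
      Set.preimage_univ, Measure.pi_univ, smul_eq_mul, ENNReal.ofReal_mul (by positivity),
      ENNReal.ofReal_pow (by positivity)]
    simp [Measure.real]
  simp_rw [h]
  have hs := hasSum_exp_mul_pow (Λ.real Set.univ) (Λ.real Set.univ)
  rw [← ENNReal.ofReal_tsum_of_nonneg (fun k => by positivity) hs.summable, hs.tsum_eq]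
  simp

theorem integrable_expNeg_comp {X : Type*} [MeasurableSpace X] (Λ : Measure X)
    [IsFiniteMeasure Λ] {f : X → ℝ≥0} (hf : Measurable f) :
    Integrable (fun x => expNeg (f x)) Λ :=
  integrable_expNeg hf.coe_nnreal_ennreal.aemeasurable

theorem lintegral_oneSubExp_of_isFiniteMeasure {X : Type*} [MeasurableSpace X] (Λ : Measure X)
    [IsFiniteMeasure Λ] {f : X → ℝ≥0} (hf : Measurable f) :
    expNeg (∫⁻ x, oneSubExp (f x) ∂Λ)
      = Real.exp (-Λ.real Set.univ + ∫ x, expNeg (f x) ∂Λ) := by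
  have hi : Integrable (fun x => 1 - expNeg (f x)) Λ :=
    (integrable_const _).sub (integrable_expNeg_comp Λ hf)
  have hn : ∀ x, 0 ≤ 1 - expNeg (f x) := fun x => sub_nonneg.2 (expNeg_le_one _)
  have h1 : ∫⁻ x, oneSubExp (f x) ∂Λ = ENNReal.ofReal (∫ x, (1 - expNeg (f x)) ∂Λ) := by
    rw [ofReal_integral_eq_lintegral_ofReal hi (ae_of_all _ hn)]
    simp_rw [expNeg_coe]
    rfl
  rw [h1, expNeg_ofReal (integral_nonneg hn),
    integral_sub (integrable_const _) (integrable_expNeg_comp Λ hf)]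
  simp only [integral_const, smul_eq_mul, mul_one]
  congr 1; ring

/-- The component with k points contributes its weight times (∫ e^{-f} dΛ)^k by Fubini; summing the
exponential series gives exp(-∫ (1 - e^{-f}) dΛ). -/
theorem laplace_finitePoissonLaw {X : Type*} [MeasurableSpace X] (Λ : Measure X)
    [IsFiniteMeasure Λ] {f : X → ℝ≥0} (hf : Measurable f) :
    laplaceFunctional (finitePoissonLaw Λ) f = expNeg (∫⁻ x, oneSubExp (f x) ∂Λ) := by
  have := isProbabilityMeasure_finitePoissonLaw Λ
  have hm := measurable_laplace_integrand hf
  have hint : Integrable (fun μ : Measure X => expNeg (∫⁻ x, (f x : ℝ≥0∞) ∂μ))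
      (finitePoissonLaw Λ) :=
    integrable_expNeg (Measure.measurable_lintegral hf.coe_nnreal_ennreal).aemeasurable
  rw [lintegral_oneSubExp_of_isFiniteMeasure Λ hf, laplaceFunctional, finitePoissonLaw,
    integral_sum_measure hint]
  rw [← (hasSum_exp_mul_pow (Λ.real Set.univ) (∫ x, expNeg (f x) ∂Λ)).tsum_eq]
  congr 1; ext1 k
  rw [integral_smul_measure, integral_map (measurable_sum_dirac k).aemeasurable
    hm.aestronglyMeasurable, ENNReal.toReal_ofReal (by positivity), smul_eq_mul]
  congr 1
  simp_rw [lintegral_finsetSum_measure, lintegral_dirac' _ hf.coe_nnreal_ennreal, expNeg_sum]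
  rw [integral_fintype_prod_eq_prod (fun (_ : Fin k) x => expNeg (f x))]
  simp

theorem measurable_measure_sum {X : Type*} [MeasurableSpace X] :
    Measurable fun m : ℕ → Measure X => Measure.sum m := by
  refine Measure.measurable_of_measurable_coe _ fun s hs => ?_
  simp_rw [Measure.sum_apply _ hs]
  exact Measurable.tsum fun n => (Measure.measurable_coe hs).comp (measurable_pi_apply n)

/-- The law of the Poisson random measure with s-finite mean measure `Λ`. -/
noncomputable def poissonLaw {X : Type*} [MeasurableSpace X] (Λ : Measure X) [SFinite Λ] :
    Measure (Measure X) :=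
  (Measure.infinitePi fun n => finitePoissonLaw (sfiniteSeq Λ n)).map Measure.sum

theorem isProbabilityMeasure_poissonLaw {X : Type*} [MeasurableSpace X] (Λ : Measure X)
    [SFinite Λ] : IsProbabilityMeasure (poissonLaw Λ) := by
  have := fun n => isProbabilityMeasure_finitePoissonLaw (sfiniteSeq Λ n)
  exact Measure.isProbabilityMeasure_map measurable_measure_sum.aemeasurable

/-- For finitely many independent summands the Laplace functionals multiply; dominated convergence
passes to the full superposition. -/
theorem laplace_poissonLaw {X : Type*} [MeasurableSpace X] (Λ : Measure X)
    [SFinite Λ] {f : X → ℝ≥0} (hf : Measurable f) :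
    laplaceFunctional (poissonLaw Λ) f = expNeg (∫⁻ x, oneSubExp (f x) ∂Λ) := by
  have := fun n => isProbabilityMeasure_finitePoissonLaw (sfiniteSeq Λ n)
  have hm := measurable_laplace_integrand hf
  have hpart : ∀ n, Measurable fun m : ℕ → Measure X =>
      expNeg (∑ i ∈ Finset.range n, ∫⁻ x, (f x : ℝ≥0∞) ∂(m i)) := fun n =>
    measurable_expNeg.comp (Finset.measurable_sum _ fun i _ =>
      (Measure.measurable_lintegral hf.coe_nnreal_ennreal).comp (measurable_pi_apply i))
  rw [laplaceFunctional, poissonLaw, integral_map measurable_measure_sum.aemeasurable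
    hm.aestronglyMeasurable]
  simp_rw [lintegral_sum_measure]
  have h1 : Tendsto (fun n => ∫ m : ℕ → Measure X,
      expNeg (∑ i ∈ Finset.range n, ∫⁻ x, (f x : ℝ≥0∞) ∂(m i))
        ∂(Measure.infinitePi fun n => finitePoissonLaw (sfiniteSeq Λ n))) atTop
      (𝓝 (∫ m : ℕ → Measure X, expNeg (∑' i, ∫⁻ x, (f x : ℝ≥0∞) ∂(m i))
        ∂(Measure.infinitePi fun n => finitePoissonLaw (sfiniteSeq Λ n)))) :=
    tendsto_integral_of_dominated_convergence (fun _ => 1)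
      (fun n => (hpart n).aestronglyMeasurable) (integrable_const _)
      (fun n => ae_of_all _ fun m => norm_expNeg_le _)
      (ae_of_all _ fun m => (continuous_expNeg.tendsto _).comp
        (ENNReal.tendsto_nat_tsum _))
  refine tendsto_nhds_unique h1 ?_
  have h2 : ∀ n, ∫ m : ℕ → Measure X,
      expNeg (∑ i ∈ Finset.range n, ∫⁻ x, (f x : ℝ≥0∞) ∂(m i))
        ∂(Measure.infinitePi fun n => finitePoissonLaw (sfiniteSeq Λ n))
      = expNeg (∑ i ∈ Finset.range n, ∫⁻ x, oneSubExp (f x) ∂(sfiniteSeq Λ i)) := by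
    intro n
    have h3 := integral_restrict_infinitePi
      (μ := fun n => finitePoissonLaw (sfiniteSeq Λ n)) (s := Finset.range n)
      (f := fun m => ∏ i, expNeg (∫⁻ x, (f x : ℝ≥0∞) ∂(m i)))
      (Measurable.aestronglyMeasurable (Finset.measurable_prod _ fun i _ =>
        hm.comp (measurable_pi_apply i)))
    rw [integral_fintype_prod_eq_prod
      (fun (_ : Finset.range n) μ => expNeg (∫⁻ x, (f x : ℝ≥0∞) ∂μ))] at h3
    simp_rw [expNeg_sum]
    simp only [Finset.restrict] at h3
    rw [← Finset.prod_coe_sort (Finset.range n)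
      fun i => expNeg (∫⁻ x, oneSubExp (f x) ∂(sfiniteSeq Λ i))]
    simp_rw [← laplace_finitePoissonLaw _ hf]
    refine Eq.trans ?_ h3
    refine integral_congr_ae (ae_of_all _ fun m => ?_)
    exact (Finset.prod_coe_sort (Finset.range n)
      fun i => expNeg (∫⁻ x, (f x : ℝ≥0∞) ∂(m i))).symm
  simp_rw [h2]
  nth_rewrite 2 [← sum_sfiniteSeq Λ]
  rw [lintegral_sum_measure]
  exact (continuous_expNeg.tendsto _).comp (ENNReal.tendsto_nat_tsum _)

/-- Existence of Poisson random measures. -/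
theorem isPoissonLaw_poissonLaw {X : Type*} [MeasurableSpace X] (Λ : Measure X) [SFinite Λ] :
    IsPoissonLaw (poissonLaw Λ) Λ :=
  have := isProbabilityMeasure_poissonLaw Λ
  isPoissonLaw_of_laplace fun _ hf => laplace_poissonLaw Λ hf

/-! ### Poisson laws depending measurably on their intensity. -/

/-- Pointwise finite masses need not be uniformly bounded, so the parameter space is cut according
to the integer part n of the mass; each piece has mass at most n + 1. -/
theorem isSFiniteKernel_of_forall_isFiniteMeasure {α X : Type*} [MeasurableSpace α]
    [MeasurableSpace X] (κ : Kernel α X) (h : ∀ a, IsFiniteMeasure (κ a)) :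
    IsSFiniteKernel κ := by
  classical
  have hs : ∀ n : ℕ, MeasurableSet {a | ⌊(κ a Set.univ).toNNReal⌋₊ = n} := fun n =>
    (Nat.measurable_floor.comp
      (κ.measurable_coe MeasurableSet.univ).ennreal_toNNReal) (measurableSet_singleton n)
  have hsum : κ = Kernel.sum fun n => Kernel.piecewise (hs n) κ 0 := by
    ext a s hms
    rw [Kernel.sum_apply, Measure.sum_apply _ hms,
      tsum_eq_single ⌊(κ a Set.univ).toNNReal⌋₊ fun n hn => ?_]
    · rw [Kernel.piecewise_apply, if_pos (by exact rfl)]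
    · rw [Kernel.piecewise_apply, if_neg (by exact fun h => hn h.symm)]
      simp
  rw [hsum]
  refine Kernel.isSFiniteKernel_sum (hκs := fun n => ?_)
  have : IsFiniteKernel (Kernel.piecewise (hs n) κ 0) := by
    refine ⟨⟨n + 1, by simp, fun a => ?_⟩⟩
    rw [Kernel.piecewise_apply]
    split_ifs with ha
    · have ha' : ⌊(κ a Set.univ).toNNReal⌋₊ = n := ha
      have := Nat.lt_floor_add_one (κ a Set.univ).toNNReal
      rw [ha'] at this
      rw [← ENNReal.coe_toNNReal (measure_ne_top (κ a) Set.univ)]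
      exact_mod_cast this.le
    · simp
  infer_instance

/-- Disjointifying the exhaustion splits the kernel into countably many pointwise finite kernels.
S-finiteness is what makes integrals over sections jointly measurable. -/
theorem isSFiniteKernel_of_forall_lt_top {α X : Type*} [MeasurableSpace α]
    [MeasurableSpace X] (κ : Kernel α X) {S : ℕ → Set X} (hS : ∀ n, MeasurableSet (S n))
    (hU : ⋃ n, S n = Set.univ) (h : ∀ a n, κ a (S n) < ∞) : IsSFiniteKernel κ := by
  have hd : ∀ n, MeasurableSet (disjointed S n) := MeasurableSet.disjointed hS
  have hsum : κ = Kernel.sum fun n => Kernel.restrict κ (hd n) := by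
    ext1 a
    rw [Kernel.sum_apply]
    simp_rw [Kernel.restrict_apply]
    rw [← Measure.restrict_iUnion (disjoint_disjointed S) hd, iUnion_disjointed, hU,
      Measure.restrict_univ]
  rw [hsum]
  refine Kernel.isSFiniteKernel_sum (hκs := fun n =>
    isSFiniteKernel_of_forall_isFiniteMeasure _ fun a => ⟨?_⟩)
  rw [Kernel.restrict_apply, Measure.restrict_apply_univ]
  exact (measure_mono (disjointed_subset S n)).trans_lt (h a n)

theorem measurableSet_forall_lt_top {X : Type*} [MeasurableSpace X] {S : ℕ → Set X}
    (hS : ∀ n, MeasurableSet (S n)) : MeasurableSet {μ : Measure X | ∀ n, μ (S n) < ∞} := by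
  rw [Set.ofPred_forall]
  exact MeasurableSet.iInter fun n => Measure.measurable_coe (hS n) measurableSet_Iio

open Classical in
/-- The kernel sending a measure that is finite on all the sets `S n` to itself, and all other
measures to `0`. -/
noncomputable def truncKernel {X : Type*} [MeasurableSpace X] (S : ℕ → Set X)
    (hS : ∀ n, MeasurableSet (S n)) : Kernel (Measure X) X :=
  Kernel.piecewise (measurableSet_forall_lt_top hS) ⟨id, measurable_id⟩ 0

theorem truncKernel_apply_of_forall {X : Type*} [MeasurableSpace X] {S : ℕ → Set X}
    (hS : ∀ n, MeasurableSet (S n)) {μ : Measure X} (h : ∀ n, μ (S n) < ∞) :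
    truncKernel S hS μ = μ := by
  classical
  rw [truncKernel, Kernel.piecewise_apply, if_pos (by exact h)]
  rfl

theorem truncKernel_apply_lt_top {X : Type*} [MeasurableSpace X] {S : ℕ → Set X}
    (hS : ∀ n, MeasurableSet (S n)) (μ : Measure X) (n : ℕ) :
    truncKernel S hS μ (S n) < ∞ := by
  classical
  rw [truncKernel, Kernel.piecewise_apply]
  split_ifs with h
  · exact h n
  · simp

theorem isSFiniteKernel_truncKernel {X : Type*} [MeasurableSpace X] {S : ℕ → Set X}
    (hS : ∀ n, MeasurableSet (S n)) (hU : ⋃ n, S n = Set.univ) :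
    IsSFiniteKernel (truncKernel S hS) :=
  isSFiniteKernel_of_forall_lt_top _ hS hU (truncKernel_apply_lt_top hS)

/-- The part of a measure `M` on `Y × ℝ` below the graph of `g`, projected to `Y`. -/
noncomputable def thinning {Y : Type*} [MeasurableSpace Y] (g : Y → ℝ≥0∞)
    (M : Measure (Y × ℝ)) : Measure Y :=
  (M.restrict {p | ENNReal.ofReal p.2 < g p.1}).map Prod.fst

theorem measurableSet_below_graph {Y : Type*} [MeasurableSpace Y] {g : Y → ℝ≥0∞}
    (hg : Measurable g) : MeasurableSet {p : Y × ℝ | ENNReal.ofReal p.2 < g p.1} :=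
  measurableSet_lt (by fun_prop) (by fun_prop)

theorem thinning_apply {Y : Type*} [MeasurableSpace Y] (g : Y → ℝ≥0∞)
    (M : Measure (Y × ℝ)) {A : Set Y} (hA : MeasurableSet A) :
    thinning g M A = M {p | p.1 ∈ A ∧ ENNReal.ofReal p.2 < g p.1} := by
  rw [thinning, Measure.map_apply measurable_fst hA, Measure.restrict_apply (measurable_fst hA)]
  rfl

theorem measurable_thinning {Y : Type*} [MeasurableSpace Y] {g : Y → ℝ≥0∞}
    (hg : Measurable g) : Measurable (thinning g) := by
  refine Measure.measurable_of_measurable_coe _ fun A hA => ?_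
  simp_rw [thinning_apply g _ hA]
  exact Measure.measurable_coe ((measurable_fst hA).inter (measurableSet_below_graph hg))

theorem lintegral_thinning {Y : Type*} [MeasurableSpace Y] {g : Y → ℝ≥0∞} (hg : Measurable g)
    (M : Measure (Y × ℝ)) {f : Y → ℝ≥0∞} (hf : Measurable f) :
    ∫⁻ y, f y ∂(thinning g M)
      = ∫⁻ p, {p : Y × ℝ | ENNReal.ofReal p.2 < g p.1}.indicator (fun p => f p.1) p ∂M := by
  rw [thinning, lintegral_map hf measurable_fst, lintegral_indicator (measurableSet_below_graph hg)]

/-- The fibre below the graph over y has length exactly g(y), also when g(y) = ∞; hence thinning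
produces the density g. -/
theorem volume_Ioi_ofReal_lt (x : ℝ≥0∞) :
    volume.restrict (Set.Ioi (0 : ℝ)) {u : ℝ | ENNReal.ofReal u < x} = x := by
  rw [Measure.restrict_apply (measurableSet_lt (by fun_prop) (by fun_prop))]
  induction x with
  | top => simp
  | coe x =>
    have : {u : ℝ | ENNReal.ofReal u < x} ∩ Set.Ioi 0 = Set.Ioo 0 (x : ℝ) := by
      ext u
      refine Iff.trans (and_congr_left fun hu => ?_) and_comm
      change ENNReal.ofReal u < x ↔ u < x
      rw [Set.mem_Ioi] at hu
      rw [← ENNReal.ofReal_coe_nnreal, ENNReal.ofReal_lt_ofReal_iff_of_nonneg hu.le]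
    rw [this]; simp

/-- Thinning a Poisson random measure with mean measure `ℓ ⊗ du` under the graph of `g` gives a
Poisson random measure with mean measure `g ℓ`. -/
theorem isPoissonLaw_map_thinning {Y : Type*} [MeasurableSpace Y] {ℓ : Measure Y} [SFinite ℓ]
    {Q : Measure (Measure (Y × ℝ))}
    (hQ : IsPoissonLaw Q (ℓ.prod (volume.restrict (Set.Ioi 0))))
    {g : Y → ℝ≥0∞} (hg : Measurable g) :
    IsPoissonLaw (Q.map (thinning g)) (ℓ.withDensity g) := by
  have := hQ.isProbabilityMeasure
  have hth := measurable_thinning hg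
  have := Measure.isProbabilityMeasure_map (μ := Q) hth.aemeasurable
  have hB := measurableSet_below_graph hg
  refine isPoissonLaw_of_laplace fun f hf => ?_
  rw [laplaceFunctional, integral_map hth.aemeasurable
    (measurable_laplace_integrand hf).aestronglyMeasurable]
  have hF : Measurable ({p : Y × ℝ | ENNReal.ofReal p.2 < g p.1}.indicator fun p => f p.1) :=
    (hf.comp measurable_fst).indicator hB
  have h1 := hQ.laplace_eq hF
  have h2 : ∀ p : Y × ℝ, oneSubExp ({p : Y × ℝ | ENNReal.ofReal p.2 < g p.1}.indicator
      (fun p => f p.1) p) = {p : Y × ℝ | ENNReal.ofReal p.2 < g p.1}.indicator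
      (fun p => oneSubExp (f p.1)) p := by
    intro p
    by_cases hp : p ∈ {p : Y × ℝ | ENNReal.ofReal p.2 < g p.1}
    · simp only [Set.indicator_of_mem hp]
    · simp only [Set.indicator_of_notMem hp, oneSubExp_zero]
  have hof : Measurable fun y => oneSubExp (f y) := continuous_oneSubExp.measurable.comp hf
  simp_rw [h2] at h1
  rw [lintegral_prod
    (f := {p : Y × ℝ | ENNReal.ofReal p.2 < g p.1}.indicator fun p => oneSubExp (f p.1))
    ((hof.comp measurable_fst).indicator hB).aemeasurable] at h1
  have h3 : ∀ y, ∫⁻ u, {p : Y × ℝ | ENNReal.ofReal p.2 < g p.1}.indicator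
      (fun p => oneSubExp (f p.1)) (y, u) ∂(volume.restrict (Set.Ioi (0 : ℝ)))
      = g y * oneSubExp (f y) := by
    intro y
    have : ∀ u, {p : Y × ℝ | ENNReal.ofReal p.2 < g p.1}.indicator
      (fun p => oneSubExp (f p.1)) (y, u)
      = {u : ℝ | ENNReal.ofReal u < g y}.indicator (fun _ => oneSubExp (f y)) u := fun u => rfl
    simp_rw [this]
    rw [lintegral_indicator_const (measurableSet_lt (by fun_prop) (by fun_prop)),
      volume_Ioi_ofReal_lt, mul_comm]
  simp_rw [h3] at h1
  rw [lintegral_withDensity_eq_lintegral_mul _ hg hof]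
  simp only [Pi.mul_apply]
  rw [← h1, laplaceFunctional]
  refine integral_congr_ae (ae_of_all _ fun M => ?_)
  simp only
  rw [lintegral_thinning hg M hf.coe_nnreal_ennreal]
  congr 1
  refine lintegral_congr fun p => ?_
  by_cases hp : p ∈ {p : Y × ℝ | ENNReal.ofReal p.2 < g p.1}
  · simp only [Set.indicator_of_mem hp]
  · simp only [Set.indicator_of_notMem hp, ENNReal.coe_zero]

/-- The kernel sending `w` to the law of a Poisson random measure with mean measure `g w · ℓ`, for a jointly
measurable density `g`. -/
theorem exists_kernel_isPoissonLaw {S Y : Type*} [MeasurableSpace S] [MeasurableSpace Y]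
    (ℓ : Measure Y) [SigmaFinite ℓ] {g : S → Y → ℝ≥0∞} (hg : Measurable (Function.uncurry g)) :
    ∃ η : Kernel S (Measure Y), IsMarkovKernel η ∧
      ∀ w, IsPoissonLaw (η w) (ℓ.withDensity (g w)) := by
  let Λ : Measure (Y × ℝ) := ℓ.prod (volume.restrict (Set.Ioi 0))
  let D : ℕ → Set (Y × ℝ) := spanningSets Λ
  have hD : ∀ n, MeasurableSet (D n) := measurableSet_spanningSets Λ
  have hQ : IsPoissonLaw (poissonLaw Λ) Λ := isPoissonLaw_poissonLaw Λ
  have hprob := hQ.isProbabilityMeasure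
  have hκ : IsSFiniteKernel (truncKernel D hD) :=
    isSFiniteKernel_truncKernel hD (iUnion_spanningSets Λ)
  have hgw : ∀ w, Measurable (g w) := fun w => hg.comp measurable_prodMk_left
  -- A Poisson measure is almost surely finite on sets of finite mean, so truncation changes nothing
  -- almost surely.
  have hae : ∀ᵐ M ∂(poissonLaw Λ), truncKernel D hD M = M := by
    have : ∀ᵐ M ∂(poissonLaw Λ), ∀ n, M (D n) < ∞ := by
      refine ae_all_iff.2 fun n => ?_
      have h1 := hQ.map_eval (D n) (hD n)
      have hlt : Λ (D n) ≠ ∞ := (measure_spanningSets_lt_top Λ n).ne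
      rw [extendedPoisson, if_neg hlt] at h1
      have h2 : ∀ᵐ x ∂((poissonLaw Λ).map fun M => M (D n)), x < ∞ := by
        rw [h1, ae_map_iff (by fun_prop) measurableSet_Iio]
        exact ae_of_all _ fun k => by simp
      exact ae_of_ae_map (Measure.measurable_coe (hD n)).aemeasurable h2
    filter_upwards [this] with M hM using truncKernel_apply_of_forall hD hM
  -- One Poisson measure serves all parameters w. The truncation makes M ↦ M an s-finite kernel,
  -- which is needed for joint measurability of the thinned measure in (w, M).
  let Φ : S × Measure (Y × ℝ) → Measure Y := fun q => thinning (g q.1) (truncKernel D hD q.2)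
  have hΦ : Measurable Φ := by
    refine Measure.measurable_of_measurable_coe _ fun A hA => ?_
    have h1 : ∀ q : S × Measure (Y × ℝ), Φ q A
        = (Kernel.prodMkLeft S (truncKernel D hD)) q (Prod.mk q ⁻¹'
          {r | r.2.1 ∈ A ∧ ENNReal.ofReal r.2.2 < g r.1.1 r.2.1}) := by
      intro q
      rw [Kernel.prodMkLeft_apply]
      exact thinning_apply _ _ hA
    simp_rw [h1]
    refine Kernel.measurable_kernel_prodMk_left (MeasurableSet.inter ?_ ?_)
    · exact (measurable_fst.comp measurable_snd) hA
    · refine measurableSet_lt (ENNReal.measurable_ofReal.comp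
        (measurable_snd.comp measurable_snd)) ?_
      exact hg.comp ((measurable_fst.comp measurable_fst).prodMk
        (measurable_fst.comp measurable_snd))
  refine ⟨(Kernel.id ×ₖ Kernel.const S (poissonLaw Λ)).map Φ,
    Kernel.IsMarkovKernel.map _ hΦ, fun w => ?_⟩
  have h1 : (Kernel.id ×ₖ Kernel.const S (poissonLaw Λ)).map Φ w
      = (poissonLaw Λ).map (thinning (g w)) := by
    rw [Kernel.map_apply _ hΦ, Kernel.prod_apply, Kernel.id_apply, Kernel.const_apply,
      Measure.dirac_prod, Measure.map_map hΦ measurable_prodMk_left]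
    refine Measure.map_congr ?_
    filter_upwards [hae] with M hM
    simp [Φ, hM]
  rw [h1]
  exact isPoissonLaw_map_thinning hQ (hgw w)

/-! ### Gamma and noncentral gamma Laplace functionals beyond BM₊. -/

/-- A metric space is exhausted by bounded measurable sets that detect bounded finiteness. -/
theorem exists_bounded_exhaustion (X : Type*) [MetricSpace X] [MeasurableSpace X]
    [BorelSpace X] : ∃ S : ℕ → Set X, (∀ n, MeasurableSet (S n)) ∧
      (∀ n, Bornology.IsBounded (S n)) ∧ Monotone S ∧ (⋃ n, S n = Set.univ) ∧
      ∀ B, Bornology.IsBounded B → ∃ n, B ⊆ S n := by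
  rcases isEmpty_or_nonempty X with hX | ⟨⟨x⟩⟩
  · exact ⟨fun _ => Set.univ, fun _ => MeasurableSet.univ,
      fun _ => by simp [Set.univ_eq_empty_iff.2 hX],
      fun _ _ _ => le_rfl, Set.iUnion_const _, fun B _ => ⟨0, Set.subset_univ B⟩⟩
  · refine ⟨fun n => Metric.closedBall x n, fun n => measurableSet_closedBall,
      fun n => Metric.isBounded_closedBall,
      fun n m h => Metric.closedBall_subset_closedBall (by exact_mod_cast h),
      Metric.iUnion_closedBall_nat x, fun B hB => ?_⟩
    obtain ⟨r, hr⟩ := hB.subset_closedBall x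
    obtain ⟨n, hn⟩ := exists_nat_ge r
    exact ⟨n, hr.trans (Metric.closedBall_subset_closedBall hn)⟩

theorem BoundedlyFinite.sigmaFinite {X : Type*} [MetricSpace X] [MeasurableSpace X]
    [BorelSpace X] {μ : Measure X} (h : BoundedlyFinite μ) : SigmaFinite μ := by
  obtain ⟨S, _, hb, _, hU, _⟩ := exists_bounded_exhaustion X
  exact ⟨⟨⟨S, fun _ => trivial, fun n => h _ (hb n), hU⟩⟩⟩

theorem exists_isBMPlus_monotone_tendsto {X : Type*} [MetricSpace X] [MeasurableSpace X]
    [BorelSpace X] {f : X → ℝ≥0} (hf : Measurable f) :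
    ∃ g : ℕ → X → ℝ≥0, (∀ n, IsBMPlus (g n)) ∧ Monotone g ∧
      ∀ x, Tendsto (fun n => g n x) atTop (𝓝 (f x)) := by
  obtain ⟨S, hS, hb, hmono, hU, _⟩ := exists_bounded_exhaustion X
  refine ⟨fun n => (S n).indicator fun x => min (f x) n, fun n => ⟨?_, ⟨n, fun x => ?_⟩, ?_⟩, ?_,
    fun x => ?_⟩
  · exact (hf.min measurable_const).indicator (hS n)
  · by_cases hx : x ∈ S n <;> simp [hx]
  · exact (hb n).subset Set.support_indicator_subset
  · intro n m hnm x
    by_cases hx : x ∈ S n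
    · have hx' := hmono hnm hx
      simp only [Set.indicator_of_mem hx, Set.indicator_of_mem hx']
      exact min_le_min le_rfl (by exact_mod_cast hnm)
    · simp [hx]
  · refine tendsto_const_nhds.congr' ?_
    obtain ⟨n, hn⟩ := Set.mem_iUnion.1 (hU ▸ Set.mem_univ x : x ∈ ⋃ n, S n)
    obtain ⟨m, hm⟩ := exists_nat_ge (f x)
    filter_upwards [eventually_ge_atTop n, eventually_ge_atTop m] with k hk hk'
    rw [Set.indicator_of_mem (hmono hk hn), min_eq_left (hm.trans (by exact_mod_cast hk'))]

/-- The function `a ↦ log (1 + k a)` from `[0, ∞)` to `[0, ∞]`. -/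
noncomputable def logOneAdd (k : ℝ) (a : ℝ≥0) : ℝ≥0∞ := ENNReal.ofReal (Real.log (1 + k * a))

theorem continuous_logOneAdd {k : ℝ} (hk : 0 ≤ k) : Continuous (logOneAdd k) := by
  unfold logOneAdd
  refine ENNReal.continuous_ofReal.comp (Continuous.log (by fun_prop) fun a => ?_)
  have : 0 ≤ k * (a : ℝ) := by positivity
  positivity

theorem logOneAdd_mono {k : ℝ} (hk : 0 ≤ k) : Monotone (logOneAdd k) := fun a b h => by
  unfold logOneAdd
  gcongr

/-- The function `a ↦ k a / (1 + k a)` from `[0, ∞)` to `[0, ∞]`. -/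
noncomputable def divOneAdd (k : ℝ) (a : ℝ≥0) : ℝ≥0∞ := ENNReal.ofReal (k * a / (1 + k * a))

theorem continuous_divOneAdd {k : ℝ} (hk : 0 ≤ k) : Continuous (divOneAdd k) := by
  unfold divOneAdd
  refine ENNReal.continuous_ofReal.comp (Continuous.div (by fun_prop) (by fun_prop) fun a => ?_)
  have : 0 ≤ k * (a : ℝ) := by positivity
  positivity

theorem divOneAdd_mono {k : ℝ} (hk : 0 ≤ k) : Monotone (divOneAdd k) := fun a b h => by
  unfold divOneAdd
  refine ENNReal.ofReal_le_ofReal ?_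
  have ha : 0 ≤ k * (a : ℝ) := by positivity
  have hb : k * (a : ℝ) ≤ k * b := by gcongr
  rw [div_le_div_iff₀ (by positivity) (by linarith)]
  nlinarith

theorem IsGammaLaw.laplace_of_measurable {X : Type*} [MetricSpace X] [MeasurableSpace X]
    [BorelSpace X] {Q : Measure (Measure X)} {H : Measure X} {b : ℝ} (hb : 0 < b)
    (h : IsGammaLaw Q H b) {f : X → ℝ≥0} (hf : Measurable f) :
    laplaceFunctional Q f = expNeg (∫⁻ x, logOneAdd b⁻¹ (f x) ∂H) := by
  have := h.isProbabilityMeasure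
  obtain ⟨g, hg, hmono, hlim⟩ := exists_isBMPlus_monotone_tendsto hf
  refine tendsto_nhds_unique
    (tendsto_laplaceFunctional Q (fun n => (hg n).measurable) hmono hlim) ?_
  have hb' : 0 ≤ b⁻¹ := by positivity
  have key := tendsto_expNeg_lintegral_of_monotone H (continuous_logOneAdd hb')
    (logOneAdd_mono hb') (fun n => (hg n).measurable) hmono hlim
  refine key.congr fun n => ?_
  rw [h.laplace_eq _ (hg n)]
  simp only [logOneAdd, div_eq_inv_mul]

theorem IsNoncentralGammaLaw.laplace_of_measurable {X : Type*} [MetricSpace X]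
    [MeasurableSpace X] [BorelSpace X] {Q : Measure (Measure X)} {H M : Measure X} {c : ℝ}
    (hc : 0 < c) (h : IsNoncentralGammaLaw Q H M c) {f : X → ℝ≥0} (hf : Measurable f) :
    laplaceFunctional Q f
      = expNeg (∫⁻ x, logOneAdd c (f x) ∂H) * expNeg (∫⁻ x, divOneAdd c (f x) ∂M) := by
  have := h.isProbabilityMeasure
  obtain ⟨g, hg, hmono, hlim⟩ := exists_isBMPlus_monotone_tendsto hf
  refine tendsto_nhds_unique
    (tendsto_laplaceFunctional Q (fun n => (hg n).measurable) hmono hlim) ?_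
  have key := (tendsto_expNeg_lintegral_of_monotone H (continuous_logOneAdd hc.le)
    (logOneAdd_mono hc.le) (fun n => (hg n).measurable) hmono hlim).mul
    (tendsto_expNeg_lintegral_of_monotone M (continuous_divOneAdd hc.le)
    (divOneAdd_mono hc.le) (fun n => (hg n).measurable) hmono hlim)
  refine key.congr fun n => ?_
  rw [h.laplace_eq _ (hg n), expNeg_add]
  rfl

theorem IsGammaLaw.unique {X : Type*} [MetricSpace X] [MeasurableSpace X]
    [BorelSpace X] {Q R : Measure (Measure X)} {H : Measure X} {b : ℝ} (hb : 0 < b)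
    (hQ : IsGammaLaw Q H b) (hR : IsGammaLaw R H b) : Q = R := by
  have := hQ.isProbabilityMeasure
  have := hR.isProbabilityMeasure
  exact ext_of_laplaceFunctional fun f hf => by
    rw [hQ.laplace_of_measurable hb hf, hR.laplace_of_measurable hb hf]

/-! ### Construction of gamma random measures. -/

/-- The Lévy measure `s⁻¹ e^{-bs} ds` of the gamma distribution with rate `b`. -/
noncomputable def gammaLevyMeasure (b : ℝ) : Measure ℝ :=
  (volume.restrict (Set.Ioi 0)).withDensity fun s => ENNReal.ofReal (s⁻¹ * Real.exp (-(b * s)))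

instance sFinite_gammaLevyMeasure (b : ℝ) : SFinite (gammaLevyMeasure b) := by
  unfold gammaLevyMeasure; infer_instance

/-- Frullani's integral for e^{-x}, with limits 1 at 0 and 0 at ∞, gives log((a + b)/b). The bound 1
- e^{-as} ≤ as supplies integrability near 0. -/
theorem lintegral_oneSubExp_gammaLevyMeasure {b : ℝ} (hb : 0 < b) (a : ℝ≥0) :
    ∫⁻ s, oneSubExp (a * s.toNNReal) ∂(gammaLevyMeasure b) = logOneAdd b⁻¹ a := by
  have hF : Measurable fun s : ℝ => oneSubExp (a * s.toNNReal) :=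
    continuous_oneSubExp.measurable.comp (by fun_prop)
  rw [gammaLevyMeasure, lintegral_withDensity_eq_lintegral_mul _ (by fun_prop) hF]
  simp only [Pi.mul_apply]
  have h1 : ∀ s ∈ Set.Ioi (0 : ℝ), ENNReal.ofReal (s⁻¹ * Real.exp (-(b * s)))
      * oneSubExp (a * s.toNNReal)
      = ENNReal.ofReal (s⁻¹ • (Real.exp (-(b * s)) - Real.exp (-((a + b) * s)))) := by
    intro s hs
    have hs' : (0 : ℝ) < s := hs
    rw [oneSubExp, ← ENNReal.ofReal_mul (by positivity)]
    congr 1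
    rw [NNReal.coe_mul, Real.coe_toNNReal _ hs'.le,
      show -(((a : ℝ) + b) * s) = -(b * s) + -(a * s) by ring, Real.exp_add, smul_eq_mul]
    ring
  rw [setLIntegral_congr_fun measurableSet_Ioi h1]
  have hnn : ∀ s ∈ Set.Ioi (0 : ℝ),
      0 ≤ s⁻¹ • (Real.exp (-(b * s)) - Real.exp (-((a + b) * s))) := by
    intro s hs
    have hs' : (0 : ℝ) < s := hs
    refine mul_nonneg (by positivity) (sub_nonneg.2 (Real.exp_le_exp.2 ?_))
    have : 0 ≤ (a : ℝ) * s := by positivity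
    nlinarith
  have hint : IntegrableOn
      (fun s : ℝ => s⁻¹ • (Real.exp (-(b * s)) - Real.exp (-((a + b) * s)))) (Set.Ioi 0) := by
    refine Integrable.mono' (g := fun s => a * Real.exp (-b * s))
      ((exp_neg_integrableOn_Ioi 0 hb).const_mul _) (by fun_prop) ?_
    refine (ae_restrict_iff' measurableSet_Ioi).2 (ae_of_all _ fun s hs => ?_)
    rw [Real.norm_of_nonneg (hnn s hs), smul_eq_mul]
    have hs' : (0 : ℝ) < s := hs
    rw [show -(((a : ℝ) + b) * s) = -(b * s) + -(a * s) by ring, Real.exp_add,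
      inv_mul_le_iff₀ hs', neg_mul]
    have h2 := Real.add_one_le_exp (-((a : ℝ) * s))
    have h3 := Real.exp_pos (-(b * s))
    nlinarith
  rw [← ofReal_integral_eq_lintegral_ofReal hint
    ((ae_restrict_iff' measurableSet_Ioi).2 (ae_of_all _ hnn)), logOneAdd]
  congr 1
  have hcont : Continuous fun x : ℝ => Real.exp (-x) := by fun_prop
  have hfr := Frullani.integral_Ioi_eq (f := fun x : ℝ => Real.exp (-x)) (a := b) (b := a + b)
    (L := 1) (R := 0) (hcont.continuousOn.locallyIntegrableOn measurableSet_Ioi) hb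
    (by positivity) ?_ Real.tendsto_exp_neg_atTop_nhds_zero hint
  · rw [hfr]
    simp only [sub_zero, smul_eq_mul, mul_one]
    congr 1
    field_simp
    ring
  · exact (hcont.tendsto' 0 1 (by simp)).mono_left nhdsWithin_le_nhds

/-- The random measure `∑ s_i δ_{x_i}` obtained from the point process `∑ δ_{(x_i, s_i)}`. -/
noncomputable def compoundMeasure {X : Type*} [MeasurableSpace X] (M : Measure (X × ℝ)) :
    Measure X :=
  (M.withDensity fun p => ENNReal.ofReal p.2).map Prod.fst

theorem lintegral_compoundMeasure {X : Type*} [MeasurableSpace X] (M : Measure (X × ℝ))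
    {f : X → ℝ≥0} (hf : Measurable f) :
    ∫⁻ x, (f x : ℝ≥0∞) ∂(compoundMeasure M)
      = ∫⁻ p, ((f p.1 * p.2.toNNReal : ℝ≥0) : ℝ≥0∞) ∂M := by
  rw [compoundMeasure, lintegral_map hf.coe_nnreal_ennreal measurable_fst,
    lintegral_withDensity_eq_lintegral_mul _ (by fun_prop)
      (g := fun p : X × ℝ => (f p.1 : ℝ≥0∞)) (hf.coe_nnreal_ennreal.comp measurable_fst)]
  refine lintegral_congr fun p => ?_
  simp [ENNReal.ofReal, mul_comm]

theorem measurable_compoundMeasure {X : Type*} [MeasurableSpace X] :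
    Measurable (compoundMeasure : Measure (X × ℝ) → Measure X) := by
  refine Measure.measurable_of_measurable_coe _ fun A hA => ?_
  have : ∀ M : Measure (X × ℝ), compoundMeasure M A
      = ∫⁻ p in Prod.fst ⁻¹' A, ENNReal.ofReal p.2 ∂M := fun M => by
    rw [compoundMeasure, Measure.map_apply measurable_fst hA,
      withDensity_apply _ (measurable_fst hA)]
  simp_rw [this, ← lintegral_indicator (measurable_fst hA)]
  exact Measure.measurable_lintegral
    ((ENNReal.measurable_ofReal.comp measurable_snd).indicator (measurable_fst hA))

/-- For t > 0, e^{-tμ(A)} vanishes when μ(A) = ∞, so its mean is at most the probability that μ(A)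
is finite; that mean tends to 1 as t decreases to 0. -/
theorem ae_lt_top_of_laplace {X : Type*} [MeasurableSpace X] {Q : Measure (Measure X)}
    [IsProbabilityMeasure Q] {H : Measure X} {b : ℝ} (hb : 0 < b)
    (h : ∀ f : X → ℝ≥0, Measurable f →
      laplaceFunctional Q f = expNeg (∫⁻ x, logOneAdd b⁻¹ (f x) ∂H))
    {A : Set X} (hA : MeasurableSet A) (hHA : H A < ∞) : ∀ᵐ μ ∂Q, μ A < ∞ := by
  have hb' : 0 ≤ b⁻¹ := by positivity
  have hms : MeasurableSet {μ : Measure X | μ A < ∞} := Measure.measurable_coe hA measurableSet_Iio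
  have h1 : ∀ t : ℝ≥0, 0 < t → expNeg (logOneAdd b⁻¹ t * H A) ≤ Q.real {μ | μ A < ∞} := by
    intro t ht
    have h2 := h (A.indicator fun _ => t) (measurable_const.indicator hA)
    have h3 : ∀ x, logOneAdd b⁻¹ (A.indicator (fun _ => t) x)
        = A.indicator (fun _ => logOneAdd b⁻¹ t) x := by
      intro x
      by_cases hx : x ∈ A <;> simp [hx, logOneAdd]
    simp_rw [h3] at h2
    rw [lintegral_indicator_const hA, laplaceFunctional] at h2
    rw [← h2, ← integral_indicator_one hms]
    refine integral_mono (integrable_expNeg (Measure.measurable_lintegral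
      (measurable_const.indicator hA).coe_nnreal_ennreal).aemeasurable)
      ((integrable_const _).indicator hms) fun μ => ?_
    simp only [ENNReal.coe_indicator]
    rw [lintegral_indicator_const hA]
    by_cases hμ : μ A < ∞
    · rw [Set.indicator_of_mem (by exact hμ)]
      exact expNeg_le_one _
    · rw [not_lt_top_iff.1 hμ, ENNReal.mul_top (by simpa using ht.ne'), expNeg_top]
      exact Set.indicator_nonneg (fun _ _ => zero_le_one) _
  have h4 : Tendsto (fun t : ℝ≥0 => expNeg (logOneAdd b⁻¹ t * H A)) (𝓝[>] 0) (𝓝 1) := by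
    have h5 : Continuous fun t : ℝ≥0 => expNeg (logOneAdd b⁻¹ t * H A) :=
      continuous_expNeg.comp ((ENNReal.continuous_mul_const hHA.ne).comp
        (continuous_logOneAdd hb'))
    exact (h5.tendsto' 0 1 (by simp [logOneAdd, expNeg_zero])).mono_left nhdsWithin_le_nhds
  have h6 : 1 ≤ Q.real {μ | μ A < ∞} :=
    le_of_tendsto h4 (eventually_nhdsWithin_of_forall fun t ht => h1 t ht)
  have h7 : Q {μ | μ A < ∞} = 1 := by
    refine le_antisymm prob_le_one ?_
    rw [← ENNReal.ofReal_one, ← ofReal_measureReal (measure_ne_top Q _)]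
    exact ENNReal.ofReal_le_ofReal h6
  exact (mem_ae_iff_prob_eq_one hms).2 h7

/-- Existence of gamma random measures. -/
theorem exists_isGammaLaw {X : Type*} [MetricSpace X] [MeasurableSpace X] [BorelSpace X]
    {H : Measure X} (hH : BoundedlyFinite H) {b : ℝ} (hb : 0 < b) :
    ∃ Q : Measure (Measure X), IsGammaLaw Q H b := by
  have := hH.sigmaFinite
  -- Atoms of size s at x occur with intensity H(dx) s⁻¹ e^{-bs} ds; summing their sizes gives the
  -- gamma measure.
  let Λ : Measure (X × ℝ) := H.prod (gammaLevyMeasure b)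
  have hΛ : IsPoissonLaw (poissonLaw Λ) Λ := isPoissonLaw_poissonLaw Λ
  have := hΛ.isProbabilityMeasure
  have hcm := measurable_compoundMeasure (X := X)
  have hprob := Measure.isProbabilityMeasure_map (μ := poissonLaw Λ) hcm.aemeasurable
  have hL : ∀ f : X → ℝ≥0, Measurable f →
      laplaceFunctional ((poissonLaw Λ).map compoundMeasure) f
        = expNeg (∫⁻ x, logOneAdd b⁻¹ (f x) ∂H) := by
    intro f hf
    rw [laplaceFunctional, integral_map hcm.aemeasurable
      (measurable_laplace_integrand hf).aestronglyMeasurable]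
    simp_rw [lintegral_compoundMeasure _ hf]
    have hF : Measurable fun p : X × ℝ => f p.1 * p.2.toNNReal :=
      (hf.comp measurable_fst).mul (measurable_real_toNNReal.comp measurable_snd)
    have h1 := hΛ.laplace_eq hF
    rw [laplaceFunctional] at h1
    rw [h1, lintegral_prod (f := fun p : X × ℝ => oneSubExp (f p.1 * p.2.toNNReal))
      (continuous_oneSubExp.measurable.comp hF).aemeasurable]
    simp_rw [lintegral_oneSubExp_gammaLevyMeasure hb]
  refine ⟨(poissonLaw Λ).map compoundMeasure, hprob, ?_, fun f hf => ?_⟩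
  · obtain ⟨S, hS, hbd, _, _, hB⟩ := exists_bounded_exhaustion X
    have : ∀ᵐ μ ∂((poissonLaw Λ).map compoundMeasure), ∀ n, μ (S n) < ∞ :=
      ae_all_iff.2 fun n => ae_lt_top_of_laplace hb hL (hS n) (hH _ (hbd n))
    filter_upwards [this] with μ hμ B hBd
    obtain ⟨n, hn⟩ := hB B hBd
    exact (measure_mono hn).trans_lt (hμ n)
  · rw [hL f hf.measurable]
    simp only [logOneAdd, div_eq_inv_mul]

theorem measurableSet_boundedlyFinite (X : Type*) [MetricSpace X] [MeasurableSpace X]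
    [BorelSpace X] : MeasurableSet {μ : Measure X | BoundedlyFinite μ} := by
  obtain ⟨S, hS, hbd, _, _, hB⟩ := exists_bounded_exhaustion X
  have : {μ : Measure X | BoundedlyFinite μ} = {μ | ∀ n, μ (S n) < ∞} := by
    ext μ
    refine ⟨fun h n => h _ (hbd n), fun h B hBd => ?_⟩
    obtain ⟨n, hn⟩ := hB B hBd
    exact (measure_mono hn).trans_lt (h n)
  rw [this]
  exact measurableSet_forall_lt_top hS

/-! ### Laplace functionals under conditioning. -/

theorem HasCondDistrib.map_snd_eq {Ω S T : Type*} [MeasurableSpace Ω] [MeasurableSpace S]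
    [MeasurableSpace T] {P : Measure Ω} {X : Ω → S} {Y : Ω → T} {η : Kernel S T}
    (h : HasCondDistrib Y X η P) : P.map Y = ((P.map X) ⊗ₘ η).map Prod.snd := by
  have h1 : HasLaw (fun ω => (X ω, Y ω)) ((P.map X) ⊗ₘ η) P := h
  rw [← h1.map_eq, AEMeasurable.map_map_of_aemeasurable measurable_snd.aemeasurable
    h1.aemeasurable]
  rfl

/-- The Laplace functional of `Y` is the mean of its conditional Laplace functional. -/
theorem HasCondDistrib.laplaceFunctional_eq {Ω S T : Type*} [MeasurableSpace Ω]
    [MeasurableSpace S] [MeasurableSpace T] {P : Measure Ω} [IsProbabilityMeasure P] {X : Ω → S}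
    {Y : Ω → Measure T} {η : Kernel S (Measure T)} [IsMarkovKernel η]
    (h : HasCondDistrib Y X η P) {f : T → ℝ≥0} (hf : Measurable f) :
    laplaceFunctional (P.map Y) f = ∫ x, laplaceFunctional (η x) f ∂(P.map X) := by
  have hm := measurable_laplace_integrand hf
  have := Measure.isProbabilityMeasure_map h.aemeasurable_fst
  rw [HasCondDistrib.map_snd_eq h, laplaceFunctional,
    integral_map measurable_snd.aemeasurable hm.aestronglyMeasurable,
    Measure.integral_compProd]
  · rfl
  · exact integrable_expNeg ((Measure.measurable_lintegral
      hf.coe_nnreal_ennreal).comp measurable_snd).aemeasurable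

/-! ### The autoregressive gamma recursion. -/

/-- The map `a ↦ r a / (1 + k a)` of `[0, ∞)`. -/
noncomputable def mobius (r k : ℝ) (a : ℝ≥0) : ℝ≥0 := (r * a / (1 + k * a)).toNNReal

theorem coe_mobius {r k : ℝ} (hr : 0 ≤ r) (hk : 0 ≤ k) (a : ℝ≥0) :
    (mobius r k a : ℝ) = r * a / (1 + k * a) :=
  Real.coe_toNNReal _ (by positivity)

theorem measurable_mobius (r k : ℝ) : Measurable (mobius r k) := by
  unfold mobius; fun_prop

theorem mobius_le {r k : ℝ} (hr : 0 ≤ r) (hk : 0 ≤ k) (a : ℝ≥0) :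
    (mobius r k a : ℝ) ≤ r * a := by
  rw [coe_mobius hr hk]
  exact div_le_self (by positivity) (by simpa using by positivity)

theorem mobius_mobius {r s k l : ℝ} (hr : 0 ≤ r) (hs : 0 ≤ s) (hk : 0 ≤ k) (hl : 0 ≤ l)
    (a : ℝ≥0) : mobius s l (mobius r k a) = mobius (s * r) (k + r * l) a := by
  rw [← NNReal.coe_inj, coe_mobius hs hl, coe_mobius hr hk,
    coe_mobius (by positivity) (by positivity)]
  have h1 : 0 < 1 + k * (a : ℝ) := by positivity
  have h2 : 0 < 1 + (k + r * l) * (a : ℝ) := by positivity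
  have h3 : 1 + l * (r * a / (1 + k * a)) = (1 + (k + r * l) * a) / (1 + k * (a : ℝ)) := by
    field_simp; ring
  rw [h3]
  field_simp

/-- Rests on (1 + ka)(1 + l · ra/(1 + ka)) = 1 + (k + rl)a. The new parameter k + rl is the one in
`mobius_mobius`, so both factors of the Laplace functional iterate together. -/
theorem logOneAdd_add_mobius {r k l : ℝ} (hr : 0 ≤ r) (hk : 0 ≤ k) (hl : 0 ≤ l) (a : ℝ≥0) :
    logOneAdd k a + logOneAdd l (mobius r k a) = logOneAdd (k + r * l) a := by
  have h0 : 0 ≤ k * (a : ℝ) := by positivity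
  have h1 : 0 ≤ l * (mobius r k a : ℝ) := by positivity
  unfold logOneAdd
  rw [← ENNReal.ofReal_add (Real.log_nonneg (by linarith)) (Real.log_nonneg (by linarith)),
    ← Real.log_mul (by positivity) (by positivity), coe_mobius hr hk]
  congr 2
  field_simp
  ring

/-- Turns the noncentral exponent with M = β `W t` into the integral of a Möbius image against `W
t`, closing the recursion. -/
theorem ofReal_mul_divOneAdd {β c : ℝ} (hβ : 0 ≤ β) (a : ℝ≥0) :
    ENNReal.ofReal β * divOneAdd c a = mobius (β * c) c a := by
  rw [divOneAdd, ← ENNReal.ofReal_mul hβ, mobius, ENNReal.ofReal]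
  congr 2
  ring

theorem measurable_logOneAdd_comp {X : Type*} [MeasurableSpace X] {k : ℝ} (hk : 0 ≤ k)
    {f : X → ℝ≥0} (hf : Measurable f) : Measurable fun x => logOneAdd k (f x) :=
  (continuous_logOneAdd hk).measurable.comp hf

theorem measurable_divOneAdd_comp {X : Type*} [MeasurableSpace X] {k : ℝ} (hk : 0 ≤ k)
    {f : X → ℝ≥0} (hf : Measurable f) : Measurable fun x => divOneAdd k (f x) :=
  (continuous_divOneAdd hk).measurable.comp hf

theorem IsMARG.laplace_succ {Ω Θ : Type*} [MeasurableSpace Ω] [MetricSpace Θ]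
    [MeasurableSpace Θ] [BorelSpace Θ] {P : Measure Ω} [IsProbabilityMeasure P] {H : Measure Θ}
    {β c : ℝ} (hβ : 0 < β) (hc : 0 < c) {W : ℕ → Ω → Measure Θ}
    (hW : IsMARG P H (fun _ => β) (fun _ => c) W) {t : ℕ} (ht : 1 ≤ t) {f : Θ → ℝ≥0}
    (hf : Measurable f) :
    laplaceFunctional (P.map (W (t + 1))) f
      = expNeg (∫⁻ x, logOneAdd c (f x) ∂H)
        * laplaceFunctional (P.map (W t)) (fun x => mobius (β * c) c (f x)) := by
  obtain ⟨η, hη, hcd, hae⟩ := hW.transition t ht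
  have hg : Measurable fun x => mobius (β * c) c (f x) := (measurable_mobius _ _).comp hf
  have hm := measurable_laplace_integrand hg
  rw [HasCondDistrib.laplaceFunctional_eq hcd hf]
  have h1 : ∀ᵐ w ∂(P.map fun ω (i : Finset.Icc 1 t) => W i ω), laplaceFunctional (η w) f
      = expNeg (∫⁻ x, logOneAdd c (f x) ∂H) * expNeg (∫⁻ x, (mobius (β * c) c (f x) : ℝ≥0∞)
        ∂(w ⟨t, Finset.mem_Icc.2 ⟨ht, le_rfl⟩⟩)) := by
    filter_upwards [hae] with w hw
    rw [hw.laplace_of_measurable hc hf, lintegral_smul_measure, smul_eq_mul,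
      ← lintegral_const_mul _ (measurable_divOneAdd_comp hc.le hf)]
    simp_rw [ofReal_mul_divOneAdd hβ.le]
  rw [integral_congr_ae h1, integral_const_mul, laplaceFunctional,
    integral_map (hW.measurable t ht).aemeasurable hm.aestronglyMeasurable,
    integral_map hcd.aemeasurable_fst]
  have hp : Measurable fun w : Finset.Icc 1 t → Measure Θ =>
      w ⟨t, Finset.mem_Icc.2 ⟨ht, le_rfl⟩⟩ := measurable_pi_apply _
  exact (hm.comp hp).aestronglyMeasurable

theorem IsMARG.laplace_add {Ω Θ : Type*} [MeasurableSpace Ω] [MetricSpace Θ]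
    [MeasurableSpace Θ] [BorelSpace Θ] {P : Measure Ω} [IsProbabilityMeasure P] {H : Measure Θ}
    {β c : ℝ} (hβ : 0 < β) (hc : 0 < c) {W : ℕ → Ω → Measure Θ}
    (hW : IsMARG P H (fun _ => β) (fun _ => c) W) (t : ℕ) {f : Θ → ℝ≥0} (hf : Measurable f) :
    laplaceFunctional (P.map (W (t + 1))) f
      = expNeg (∫⁻ x, logOneAdd (c * ∑ i ∈ Finset.range t, (β * c) ^ i) (f x) ∂H)
        * laplaceFunctional (P.map (W 1)) (fun x =>
          mobius ((β * c) ^ t) (c * ∑ i ∈ Finset.range t, (β * c) ^ i) (f x)) := by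
  induction t generalizing f with
  | zero => simp [logOneAdd, mobius, expNeg_zero]
  | succ t ih =>
    have hr : 0 ≤ β * c := by positivity
    have hk : 0 ≤ c * ∑ i ∈ Finset.range t, (β * c) ^ i := by positivity
    have hg : Measurable fun x => mobius (β * c) c (f x) := (measurable_mobius _ _).comp hf
    -- The geometric sums satisfy k_{t+1} = c + ρ k_t, the parameter produced by one more Möbius
    -- step.
    have hrec : c + β * c * (c * ∑ i ∈ Finset.range t, (β * c) ^ i)
        = c * ∑ i ∈ Finset.range (t + 1), (β * c) ^ i := by
      rw [Finset.sum_range_succ', Finset.mul_sum, Finset.mul_sum, mul_add, Finset.mul_sum,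
        add_comm]
      congr 1
      · exact Finset.sum_congr rfl fun i _ => by ring
      · simp
    rw [hW.laplace_succ hβ hc (by omega) hf, ih hg, ← mul_assoc, ← expNeg_add,
      ← lintegral_add_left (measurable_logOneAdd_comp hc.le hf)]
    simp_rw [logOneAdd_add_mobius hr hc.le hk, mobius_mobius hr (pow_nonneg hr t) hc.le hk, hrec,
      ← pow_succ]

/-- The Laplace functional of the autoregressive gamma process converges to that of the gamma
random measure, on functions that are integrable with respect to the initial mean measure. -/
theorem IsMARG.tendsto_laplace {Ω Θ : Type*} [MeasurableSpace Ω] [MetricSpace Θ]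
    [MeasurableSpace Θ] [BorelSpace Θ] {P : Measure Ω} [IsProbabilityMeasure P] {H : Measure Θ}
    {β c : ℝ} (hβ : 0 < β) (hc : 0 < c) (hρ : β * c < 1) {W : ℕ → Ω → Measure Θ}
    (hW : IsMARG P H (fun _ => β) (fun _ => c) W) {f : Θ → ℝ≥0} (hf : Measurable f)
    (hint : ∫⁻ x, (f x : ℝ≥0∞) ∂(meanMeasure P (W 1)) < ∞) :
    Tendsto (fun t => laplaceFunctional (P.map (W t)) f) atTop
      (𝓝 (expNeg (∫⁻ x, logOneAdd (c / (1 - β * c)) (f x) ∂H))) := by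
  have hr : 0 ≤ β * c := by positivity
  rw [← tendsto_add_atTop_iff_nat 1]
  simp_rw [hW.laplace_add hβ hc _ hf]
  set k : ℕ → ℝ := fun t => c * ∑ i ∈ Finset.range t, (β * c) ^ i with hkdef
  have hk0 : ∀ t, 0 ≤ k t := fun t => by simp only [hkdef]; positivity
  have hkm : Monotone k := fun s t h => by
    refine mul_le_mul_of_nonneg_left ?_ hc.le
    exact Finset.sum_le_sum_of_subset_of_nonneg (Finset.range_mono h) fun i _ _ => by positivity
  have hklim : Tendsto k atTop (𝓝 (c / (1 - β * c))) := by
    rw [div_eq_mul_inv]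
    exact (hasSum_geometric_of_lt_one hr hρ).tendsto_sum_nat.const_mul c
  have hkl : 0 ≤ c / (1 - β * c) := ge_of_tendsto' hklim hk0
  have h1 : Tendsto (fun t => expNeg (∫⁻ x, logOneAdd (k t) (f x) ∂H)) atTop
      (𝓝 (expNeg (∫⁻ x, logOneAdd (c / (1 - β * c)) (f x) ∂H))) := by
    refine (continuous_expNeg.tendsto _).comp (lintegral_tendsto_of_tendsto_of_monotone
      (fun t => ((continuous_logOneAdd (hk0 t)).measurable.comp hf).aemeasurable)
      (ae_of_all _ fun x s t h => ?_) (ae_of_all _ fun x => ?_))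
    · have := hk0 s
      have h2 := hkm h
      have h3 : 0 ≤ k s * (f x : ℝ) := by positivity
      simp only [logOneAdd]
      gcongr
    · refine (ENNReal.continuous_ofReal.tendsto _).comp ?_
      have h3 : 0 ≤ c / (1 - β * c) * (f x : ℝ) := by positivity
      exact Tendsto.log ((hklim.mul_const _).const_add 1) (by positivity)
  have h2 : Tendsto (fun t => laplaceFunctional (P.map (W 1))
      (fun x => mobius ((β * c) ^ t) (k t) (f x))) atTop (𝓝 1) := by
    have := Measure.isProbabilityMeasure_map (μ := P) (hW.measurable 1 le_rfl).aemeasurable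
    -- A random integral with finite mean is almost surely finite, so multiplying it by ρ^t sends it
    -- to 0.
    have hfin : ∀ᵐ μ ∂(P.map (W 1)), ∫⁻ x, (f x : ℝ≥0∞) ∂μ < ∞ := by
      refine ae_lt_top (Measure.measurable_lintegral hf.coe_nnreal_ennreal) ?_
      rw [← Measure.lintegral_join hf.coe_nnreal_ennreal.aemeasurable]
      exact hint.ne
    have hone : (1 : ℝ) = ∫ _, (1 : ℝ) ∂(P.map (W 1)) := by simp
    rw [show 𝓝 (1 : ℝ) = 𝓝 (∫ _, (1 : ℝ) ∂(P.map (W 1))) by rw [← hone]]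
    refine tendsto_integral_of_dominated_convergence (fun _ => 1)
      (fun t => (measurable_laplace_integrand
        ((measurable_mobius _ _).comp hf)).aestronglyMeasurable)
      (integrable_const _) (fun n => ae_of_all _ fun μ => norm_expNeg_le _) ?_
    filter_upwards [hfin] with μ hμ
    rw [← expNeg_zero]
    refine (continuous_expNeg.tendsto 0).comp ?_
    have hub : Tendsto (fun t => ENNReal.ofReal ((β * c) ^ t) * ∫⁻ x, (f x : ℝ≥0∞) ∂μ) atTop
        (𝓝 0) := by
      have h4 := ENNReal.Tendsto.mul_const (b := ∫⁻ x, (f x : ℝ≥0∞) ∂μ)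
        ((ENNReal.continuous_ofReal.tendsto 0).comp
        (tendsto_pow_atTop_nhds_zero_of_lt_one hr hρ)) (Or.inr hμ.ne)
      simpa using h4
    refine tendsto_of_tendsto_of_tendsto_of_le_of_le tendsto_const_nhds hub
      (fun _ => zero_le) fun t => ?_
    rw [← lintegral_const_mul _ hf.coe_nnreal_ennreal]
    refine lintegral_mono fun x => ?_
    have hle := mobius_le (pow_nonneg hr t) (hk0 t) (f x)
    rw [← ENNReal.ofReal_coe_nnreal, ← ENNReal.ofReal_coe_nnreal (p := f x),
      ← ENNReal.ofReal_mul (pow_nonneg hr t)]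
    exact ENNReal.ofReal_le_ofReal hle
  simpa using h1.mul h2

/-- The gamma law is stationary for the autoregressive gamma process. -/
theorem IsMARG.isGammaLaw {Ω Θ : Type*} [MeasurableSpace Ω] [MetricSpace Θ]
    [MeasurableSpace Θ] [BorelSpace Θ] {P : Measure Ω} [IsProbabilityMeasure P] {H : Measure Θ}
    {β c : ℝ} (hβ : 0 < β) (hc : 0 < c) (hρ : β * c < 1) {W : ℕ → Ω → Measure Θ}
    (hW : IsMARG P H (fun _ => β) (fun _ => c) W)
    (h : IsGammaLaw (P.map (W 1)) H ((1 - β * c) / c)) {t : ℕ} (ht : 1 ≤ t) :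
    IsGammaLaw (P.map (W t)) H ((1 - β * c) / c) := by
  have hb : 0 < (1 - β * c) / c := div_pos (by linarith) hc
  induction t, ht using Nat.le_induction with
  | base => exact h
  | succ t ht ih =>
    refine ⟨Measure.isProbabilityMeasure_map (hW.measurable _ (by omega)).aemeasurable,
      (ae_map_iff (hW.measurable _ (by omega)).aemeasurable (measurableSet_boundedlyFinite Θ)).2
        (hW.ae_boundedlyFinite _ (by omega)), fun f hf => ?_⟩
    have hr : 0 ≤ β * c := by positivity
    -- The inverse rate c/(1 - ρ) is the fixed point of k ↦ c + ρk.
    have hfix : c + β * c * ((1 - β * c) / c)⁻¹ = ((1 - β * c) / c)⁻¹ := by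
      have : 1 - β * c ≠ 0 := by linarith
      rw [inv_div, eq_div_iff this, add_mul, mul_assoc, div_mul_cancel₀ _ this]
      ring
    have hg : Measurable fun x => mobius (β * c) c (f x) :=
      (measurable_mobius _ _).comp hf.measurable
    rw [hW.laplace_succ hβ hc ht hf.measurable,
      ih.laplace_of_measurable hb hg, ← expNeg_add,
      ← lintegral_add_left (measurable_logOneAdd_comp hc.le hf.measurable)]
    simp_rw [logOneAdd_add_mobius hr hc.le (inv_nonneg.2 hb.le), hfix]
    simp only [logOneAdd, div_eq_inv_mul]

/-- If the law of `X` and the conditional law of `Y` given `X` are determined, so is the law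
of `Y`. -/
theorem CondLawSatisfies.map_eq {Ω Ω' S T : Type*} [MeasurableSpace Ω] [MeasurableSpace Ω']
    [MeasurableSpace S] [MeasurableSpace T] {P : Measure Ω} [IsProbabilityMeasure P]
    {P' : Measure Ω'} {X : Ω → S} {Y : Ω → T}
    {X' : Ω' → S} {Y' : Ω' → T} {R : S → Measure T → Prop}
    (h : CondLawSatisfies P X Y R) (h' : CondLawSatisfies P' X' Y' R)
    (hX : P.map X = P'.map X') (hR : ∀ x Q Q', R x Q → R x Q' → Q = Q') :
    P.map Y = P'.map Y' := by
  obtain ⟨η, hη, hcd, hae⟩ := h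
  obtain ⟨η', hη', hcd', hae'⟩ := h'
  have := Measure.isProbabilityMeasure_map hcd.aemeasurable_fst
  rw [HasCondDistrib.map_snd_eq hcd, HasCondDistrib.map_snd_eq hcd', ← hX]
  rw [← hX] at hae'
  congr 1
  refine Measure.compProd_congr ?_
  filter_upwards [hae, hae'] with x hx hx' using hR x _ _ hx hx'

/-! ### Shot-noise Cox processes and the Poisson-gamma field. -/

/-- The mean `∫ (1 - e^{-f(y)}) K(y, θ) ℓ(dy)`. -/
noncomputable def shotNoiseTransform {Θ 𝕐 : Type*} [MeasurableSpace 𝕐] (K : 𝕐 → Θ → ℝ≥0)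
    (ℓ : Measure 𝕐) (f : 𝕐 → ℝ≥0) (θ : Θ) : ℝ≥0∞ :=
  ∫⁻ y, oneSubExp (f y) * K y θ ∂ℓ

theorem measurable_shotNoiseTransform {Θ 𝕐 : Type*} [MeasurableSpace Θ] [MeasurableSpace 𝕐]
    {K : 𝕐 → Θ → ℝ≥0} (hK : Measurable (Function.uncurry K)) (ℓ : Measure 𝕐) [SFinite ℓ]
    {f : 𝕐 → ℝ≥0} (hf : Measurable f) : Measurable (shotNoiseTransform K ℓ f) := by
  have hF : Measurable fun p : 𝕐 × Θ => oneSubExp (f p.1) * (K p.1 p.2 : ℝ≥0∞) :=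
    (continuous_oneSubExp.measurable.comp (hf.comp measurable_fst)).mul hK.coe_nnreal_ennreal
  exact hF.lintegral_prod_left'

theorem lintegral_shotNoiseTransform {Θ 𝕐 : Type*} [MeasurableSpace Θ] [MeasurableSpace 𝕐]
    {K : 𝕐 → Θ → ℝ≥0} (hK : Measurable (Function.uncurry K)) (ℓ : Measure 𝕐) [SFinite ℓ]
    {f : 𝕐 → ℝ≥0} (hf : Measurable f) (w : Measure Θ) [SFinite w] :
    ∫⁻ θ, shotNoiseTransform K ℓ f θ ∂w
      = ∫⁻ y, oneSubExp (f y) * ∫⁻ θ, (K y θ : ℝ≥0∞) ∂w ∂ℓ := by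
  have hF : Measurable fun p : 𝕐 × Θ => oneSubExp (f p.1) * (K p.1 p.2 : ℝ≥0∞) :=
    (continuous_oneSubExp.measurable.comp (hf.comp measurable_fst)).mul hK.coe_nnreal_ennreal
  have hKy : ∀ y, Measurable fun θ => (K y θ : ℝ≥0∞) := fun y =>
    hK.coe_nnreal_ennreal.comp measurable_prodMk_left
  simp_rw [← lintegral_const_mul _ (hKy _)]
  exact (lintegral_lintegral_swap hF.aemeasurable).symm

theorem lintegral_oneSubExp_shotNoiseIntensity {Θ 𝕐 : Type*} [MeasurableSpace Θ]
    [MeasurableSpace 𝕐] {K : 𝕐 → Θ → ℝ≥0} (hK : Measurable (Function.uncurry K))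
    (ℓ : Measure 𝕐) [SFinite ℓ] {f : 𝕐 → ℝ≥0} (hf : Measurable f) (w : Measure Θ) [SFinite w] :
    ∫⁻ y, oneSubExp (f y) ∂(shotNoiseIntensity 1 K ℓ w)
      = ∫⁻ θ, shotNoiseTransform K ℓ f θ ∂w := by
  have hof : Measurable fun y => oneSubExp (f y) := continuous_oneSubExp.measurable.comp hf
  have hg : Measurable fun y => ∫⁻ θ, (K y θ : ℝ≥0∞) ∂w :=
    hK.coe_nnreal_ennreal.lintegral_prod_right'
  rw [shotNoiseIntensity, lintegral_shotNoiseTransform hK ℓ hf w]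
  simp only [ENNReal.coe_one, one_mul]
  rw [lintegral_withDensity_eq_lintegral_mul _ hg hof]
  simp only [Pi.mul_apply, mul_comm]

/-- The Laplace functional of a shot-noise Cox process in terms of the driving random measure. -/
theorem laplaceFunctional_shotNoise {Ω Θ 𝕐 : Type*} [MeasurableSpace Ω] [MetricSpace Θ]
    [MeasurableSpace Θ] [BorelSpace Θ] [MeasurableSpace 𝕐] {P : Measure Ω}
    [IsProbabilityMeasure P] {K : 𝕐 → Θ → ℝ≥0} (hK : Measurable (Function.uncurry K))
    {ℓ : Measure 𝕐} [SFinite ℓ] {W : Ω → Measure Θ} {N : Ω → Measure 𝕐}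
    (hW : ∀ᵐ w ∂(P.map W), BoundedlyFinite w)
    (h : CondLawSatisfies P W N (fun w Q => IsPoissonLaw Q (shotNoiseIntensity 1 K ℓ w)))
    {f : 𝕐 → ℝ≥0} (hf : Measurable f) (hfin : ∀ θ, shotNoiseTransform K ℓ f θ ≠ ∞) :
    laplaceFunctional (P.map N) f
      = laplaceFunctional (P.map W) (fun θ => (shotNoiseTransform K ℓ f θ).toNNReal) := by
  obtain ⟨η, hη, hcd, hae⟩ := h
  rw [HasCondDistrib.laplaceFunctional_eq hcd hf]
  refine integral_congr_ae ?_
  filter_upwards [hW, hae] with w hw hP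
  have := hw.sigmaFinite
  rw [hP.laplace_eq hf, lintegral_oneSubExp_shotNoiseIntensity hK ℓ hf w]
  simp_rw [ENNReal.coe_toNNReal (hfin _)]

/-- Existence of the Poisson-gamma random field. -/
theorem exists_isPoissonGammaFieldLaw {Θ 𝕐 : Type*} [MetricSpace Θ] [MeasurableSpace Θ]
    [BorelSpace Θ] [MeasurableSpace 𝕐] {H : Measure Θ} (hH : BoundedlyFinite H) {b : ℝ}
    (hb : 0 < b) {K : 𝕐 → Θ → ℝ≥0} (hK : Measurable (Function.uncurry K)) (ℓ : Measure 𝕐)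
    [SigmaFinite ℓ] : ∃ Q : Measure (Measure 𝕐), IsPoissonGammaFieldLaw Q H b K ℓ := by
  obtain ⟨G, hG⟩ := exists_isGammaLaw hH hb
  have := hG.isProbabilityMeasure
  obtain ⟨S, hS, hbd, _, hU, _⟩ := exists_bounded_exhaustion Θ
  have hκ : IsSFiniteKernel (truncKernel S hS) := isSFiniteKernel_truncKernel hS hU
  -- The density is built from the truncated kernel to be jointly measurable; gamma measures are
  -- almost surely boundedly finite, so it is almost surely the true shot-noise density.
  let g : Measure Θ → 𝕐 → ℝ≥0∞ := fun w y => ∫⁻ θ, (K y θ : ℝ≥0∞) ∂(truncKernel S hS w)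
  have hg : Measurable (Function.uncurry g) := by
    have h1 : Measurable (Function.uncurry fun (p : Measure Θ × 𝕐) θ => (K p.2 θ : ℝ≥0∞)) :=
      hK.coe_nnreal_ennreal.comp ((measurable_snd.comp measurable_fst).prodMk measurable_snd)
    exact h1.lintegral_kernel_prod_right (κ := Kernel.prodMkRight 𝕐 (truncKernel S hS))
  obtain ⟨η, hη, hP⟩ := exists_kernel_isPoissonLaw ℓ hg
  have hfst : (G ⊗ₘ η).map Prod.fst = G := Measure.fst_compProd G η
  refine ⟨(G ⊗ₘ η).map Prod.snd, G ⊗ₘ η, inferInstance, by rwa [hfst], ⟨η, hη, ?_, ?_⟩, rfl⟩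
  · refine ⟨measurable_id.aemeasurable, ?_⟩
    rw [hfst]
    exact Measure.map_id
  · rw [hfst]
    filter_upwards [hG.ae_boundedlyFinite] with w hw
    have h1 := hP w
    have h2 : truncKernel S hS w = w := truncKernel_apply_of_forall hS fun n => hw _ (hbd n)
    simp only [g, h2] at h1
    simpa [shotNoiseIntensity] using h1

theorem oneSubExp_le_one (a : ℝ≥0) : oneSubExp a ≤ 1 := by
  rw [oneSubExp, ← ENNReal.ofReal_one]
  exact ENNReal.ofReal_le_ofReal (sub_le_self _ (Real.exp_nonneg _))

/-- As 1 - e^{-f} is at most the indicator of B, integrability hypotheses on bounded sets control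
the transform of f. -/
theorem lintegral_oneSubExp_mul_le {Y : Type*} [MeasurableSpace Y] (ℓ : Measure Y)
    {f : Y → ℝ≥0} {B : Set Y} (hB : MeasurableSet B) (hf : Function.support f ⊆ B)
    (g : Y → ℝ≥0∞) : ∫⁻ y, oneSubExp (f y) * g y ∂ℓ ≤ ∫⁻ y in B, g y ∂ℓ := by
  rw [← lintegral_indicator hB]
  refine lintegral_mono fun y => ?_
  by_cases hy : y ∈ B
  · simpa [hy] using mul_le_mul_left (oneSubExp_le_one (f y)) (g y)
  · have : f y = 0 := by
      by_contra h
      exact hy (hf h)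
    simp [this, oneSubExp_zero]

/-- Domination by log(1 + x) ≤ x. -/
theorem integrable_log_one_add_mul {X : Type*} [MeasurableSpace X] {μ : Measure X} {h : X → ℝ≥0}
    (hm : Measurable h) (hint : ∫⁻ x, (h x : ℝ≥0∞) ∂μ < ∞) {k : ℝ} (hk : 0 ≤ k) :
    Integrable (fun x => Real.log (1 + k * h x)) μ := by
  have h1 : Integrable (fun x => (h x : ℝ)) μ := by
    refine ⟨hm.coe_nnreal_real.aestronglyMeasurable, ?_⟩
    rw [hasFiniteIntegral_iff_ofReal (f := fun x => (h x : ℝ))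
      (ae_of_all _ fun x => NNReal.coe_nonneg (h x))]
    simpa using hint
  refine (h1.const_mul k).mono' (Measurable.aestronglyMeasurable
    (Real.measurable_log.comp (by fun_prop))) (ae_of_all _ fun x => ?_)
  have h2 : 0 ≤ k * (h x : ℝ) := by positivity
  rw [Real.norm_of_nonneg (Real.log_nonneg (by linarith))]
  linarith [Real.log_le_sub_one_of_pos (show 0 < 1 + k * (h x : ℝ) by linarith)]

theorem expNeg_lintegral_logOneAdd {X : Type*} [MeasurableSpace X] {μ : Measure X} {h : X → ℝ≥0}
    (hm : Measurable h) (hint : ∫⁻ x, (h x : ℝ≥0∞) ∂μ < ∞) {k : ℝ} (hk : 0 ≤ k) :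
    expNeg (∫⁻ x, logOneAdd k (h x) ∂μ) = Real.exp (-∫ x, Real.log (1 + k * h x) ∂μ) := by
  have hn : ∀ x, 0 ≤ Real.log (1 + k * h x) := fun x => by
    have h2 : 0 ≤ k * (h x : ℝ) := by positivity
    exact Real.log_nonneg (by linarith)
  rw [← expNeg_ofReal (integral_nonneg hn),
    ofReal_integral_eq_lintegral_ofReal (integrable_log_one_add_mul hm hint hk) (ae_of_all _ hn)]
  rfl

theorem integrable_and_integral_shotNoise {Θ 𝕐 : Type*} [MeasurableSpace Θ] [MeasurableSpace 𝕐]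
    {K : 𝕐 → Θ → ℝ≥0} (hK : Measurable (Function.uncurry K)) (ℓ : Measure 𝕐)
    {f : 𝕐 → ℝ≥0} (hf : Measurable f) {θ : Θ} (hfin : shotNoiseTransform K ℓ f θ ≠ ∞) :
    Integrable (fun y => (1 - Real.exp (-(f y : ℝ))) * (K y θ : ℝ)) ℓ ∧
      ∫ y, (1 - Real.exp (-(f y : ℝ))) * (K y θ : ℝ) ∂ℓ
        = (shotNoiseTransform K ℓ f θ).toNNReal := by
  have hKθ : Measurable fun y => K y θ := hK.comp measurable_prodMk_right
  have h1 : ∀ y, 0 ≤ 1 - Real.exp (-(f y : ℝ)) := fun y => by simp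
  have hn : ∀ y, 0 ≤ (1 - Real.exp (-(f y : ℝ))) * (K y θ : ℝ) := fun y =>
    mul_nonneg (h1 y) (K y θ).2
  have hm : Measurable fun y => (1 - Real.exp (-(f y : ℝ))) * (K y θ : ℝ) := by fun_prop
  have heq : ∫⁻ y, ENNReal.ofReal ((1 - Real.exp (-(f y : ℝ))) * (K y θ : ℝ)) ∂ℓ
      = shotNoiseTransform K ℓ f θ := by
    refine lintegral_congr fun y => ?_
    rw [ENNReal.ofReal_mul (h1 y), ENNReal.ofReal_coe_nnreal]
    rfl
  refine ⟨⟨hm.aestronglyMeasurable, ?_⟩, ?_⟩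
  · rw [hasFiniteIntegral_iff_ofReal (ae_of_all _ hn), heq]
    exact hfin.lt_top
  · rw [integral_eq_lintegral_of_nonneg_ae (ae_of_all _ hn) hm.aestronglyMeasurable, heq]
    rfl

/-! ### The limit law and stationarity. -/

theorem proposition6 {Ω Θ 𝕐 : Type*}
    [MeasurableSpace Ω]
    [MetricSpace Θ] [PolishSpace Θ] [MeasurableSpace Θ] [BorelSpace Θ]
    [MetricSpace 𝕐] [PolishSpace 𝕐] [MeasurableSpace 𝕐] [BorelSpace 𝕐]
    (P : Measure Ω) [IsProbabilityMeasure P]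
    (H : Measure Θ) (hH : BoundedlyFinite H)
    (ℓ : Measure 𝕐) [SigmaFinite ℓ]
    (K : 𝕐 → Θ → ℝ≥0) (hK : Measurable (Function.uncurry K))
    (β c : ℝ) (hβ : 0 < β) (hc : 0 < c) (hρ : β * c < 1)
    (W : ℕ → Ω → Measure Θ) (N : ℕ → Ω → Measure 𝕐)
    (hN : IsSNMARG P H (fun _ => β) (fun _ => c) (fun _ => 1) K ℓ W N)
    (hW₁ : BoundedlyFinite (meanMeasure P (W 1)))
    (hint₁ : ∀ B : Set 𝕐, MeasurableSet B → Bornology.IsBounded B →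
      ∀ θ, ∫⁻ y in B, (K y θ : ℝ≥0∞) ∂ℓ < ∞)
    (hint₂ : ∀ B : Set 𝕐, MeasurableSet B → Bornology.IsBounded B →
      ∫⁻ y in B, ∫⁻ θ, (K y θ : ℝ≥0∞) ∂(H + meanMeasure P (W 1)) ∂ℓ < ∞) :
    ∃ Q : Measure (Measure 𝕐),
      IsPoissonGammaFieldLaw Q H ((1 - β * c) / c) K ℓ ∧
      (∀ f : 𝕐 → ℝ≥0, IsBMPlus f →
        (∀ θ, Integrable (fun y => (1 - Real.exp (-(f y : ℝ))) * (K y θ : ℝ)) ℓ) ∧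
        Integrable (fun θ => Real.log (1 + c / (1 - β * c) *
          ∫ y, (1 - Real.exp (-(f y : ℝ))) * (K y θ : ℝ) ∂ℓ)) H ∧
        laplaceFunctional Q f = Real.exp (-∫ θ, Real.log (1 + c / (1 - β * c) *
          ∫ y, (1 - Real.exp (-(f y : ℝ))) * (K y θ : ℝ) ∂ℓ) ∂H) ∧
        Tendsto (fun t => laplaceFunctional (P.map (N t)) f) atTop
          (𝓝 (laplaceFunctional Q f))) ∧
      (IsGammaLaw (P.map (W 1)) H ((1 - β * c) / c) → ∀ t, 1 ≤ t → P.map (N t) = Q) := by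
  have hb : 0 < (1 - β * c) / c := div_pos (by linarith) hc
  have hk : 0 ≤ c / (1 - β * c) := div_nonneg hc.le (by linarith)
  have hMARG := hN.isMARG
  obtain ⟨Q, J, hJ, hG, hJc, rfl⟩ := exists_isPoissonGammaFieldLaw hH hb hK ℓ
  refine ⟨J.map Prod.snd, ⟨J, hJ, hG, hJc, rfl⟩, fun f hf => ?_, fun hW t ht => ?_⟩
  · obtain ⟨S, hS, hbd, _, _, hB⟩ := exists_bounded_exhaustion 𝕐
    obtain ⟨n, hn⟩ := hB _ hf.bounded_support
    have hfin : ∀ θ, shotNoiseTransform K ℓ f θ ≠ ∞ := fun θ =>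
      ((lintegral_oneSubExp_mul_le ℓ (hS n) hn _).trans_lt (hint₁ _ (hS n) (hbd n) θ)).ne
    set h : Θ → ℝ≥0 := fun θ => (shotNoiseTransform K ℓ f θ).toNNReal with hdef
    have hm : Measurable h :=
      (measurable_shotNoiseTransform hK ℓ hf.measurable).ennreal_toNNReal
    have hHW : BoundedlyFinite (H + meanMeasure P (W 1)) := fun B hB => by
      rw [Measure.add_apply]
      exact ENNReal.add_lt_top.2 ⟨hH B hB, hW₁ B hB⟩
    have := hHW.sigmaFinite
    -- Tonelli moves the bound to the hypothesis on H plus the initial mean. The H part makes the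
    -- logarithm integrable; the other part drives the convergence.
    have hsum : ∫⁻ θ, (h θ : ℝ≥0∞) ∂(H + meanMeasure P (W 1)) < ∞ := by
      simp_rw [hdef, ENNReal.coe_toNNReal (hfin _)]
      rw [lintegral_shotNoiseTransform hK ℓ hf.measurable]
      exact (lintegral_oneSubExp_mul_le ℓ (hS n) hn _).trans_lt (hint₂ _ (hS n) (hbd n))
    rw [lintegral_add_measure, ENNReal.add_lt_top] at hsum
    have hval : ∀ θ, ∫ y, (1 - Real.exp (-(f y : ℝ))) * (K y θ : ℝ) ∂ℓ = h θ := fun θ =>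
      (integrable_and_integral_shotNoise hK ℓ hf.measurable (hfin θ)).2
    have hQ : laplaceFunctional (J.map Prod.snd) f
        = expNeg (∫⁻ θ, logOneAdd (c / (1 - β * c)) (h θ) ∂H) := by
      rw [laplaceFunctional_shotNoise hK hG.ae_boundedlyFinite hJc hf.measurable hfin,
        hG.laplace_of_measurable hb hm, inv_div]
    simp_rw [hval]
    refine ⟨fun θ => (integrable_and_integral_shotNoise hK ℓ hf.measurable (hfin θ)).1,
      integrable_log_one_add_mul hm hsum.1 hk,
      hQ.trans (expNeg_lintegral_logOneAdd hm hsum.1 hk), ?_⟩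
    rw [hQ]
    refine (hMARG.tendsto_laplace hβ hc hρ hm hsum.2).congr' ?_
    -- The process is unconstrained at index 0, so the identity holds only from t = 1 on.
    filter_upwards [eventually_ge_atTop 1] with t ht
    exact (laplaceFunctional_shotNoise hK
      ((ae_map_iff (hMARG.measurable t ht).aemeasurable (measurableSet_boundedlyFinite Θ)).2
        (hMARG.ae_boundedlyFinite t ht)) (hN.observation t ht) hf.measurable hfin).symm
  · exact CondLawSatisfies.map_eq (hN.observation t ht) hJc
      ((hMARG.isGammaLaw hβ hc hρ hW ht).unique hb hG) fun _ _ _ h h' => h.unique h'
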